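/- Let $R=\bigoplus_{n\ge 0}R_n$ be a Noetherian commutative $\mathbb{N}_0$-graded ring which is homogeneous, i.e. generated as an $R_0$-algebra by $R_1$, and whose base ring $(R_0,\mathfrak{m}_0)$ is local. Let $R_+=\bigoplus_{n>0}R_n$, let $\mathfrak{q}_0\subseteq R_0$ be an $\mathfrak{m}_0$-primary ideal, and let $M=\bigoplus_{n\in\mathbb{Z}}M_n$ be a finitely generated graded $R$-module. Let $$R_0''\xleftarrow{\;g_0\;}R_0'\xrightarrow{\;f_0\;}R_0$$ be homomorphisms of Noetherian local rings such that $f_0$ is surjective, $g_0$ is flat, and the maximal ideal of $R_0''$ is generated by the image under $g_0$ of the maximal ideal of $R_0'$. Regard $R\otimes_{R_0'}R_0''$ as a graded ring and $M\otimes_{R_0'}R_0''$ as a graded module over it, with components $R_n\otimes_{R_0'}R_0''$ and $M_n\otimes_{R_0'}R_0''$, and regard $R_+\otimes_{R_0'}R_0''$ as an ideal of $R\otimes_{R_0'}R_0''$. Then for all $i\in\mathbb{N}_0$ and all $n\in\mathbb{Z}$, $$e_{\mathfrak{q}_0}\bigl(H^i_{R_+}(M)_n\bigr)=e_{f_0^{-1}(\mathfrak{q}_0)R_0''}\bigl(H^i_{R_+\otimes_{R_0'}R_0''}(M\otimes_{R_0'}R_0'')_n\bigr).$$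 Here, for a homogeneous ideal $J$, $H^i_J(-)_n$ denotes the degree-$n$ component of the $i$-th graded local cohomology module, i.e. the $i$-th right derived functor of $X\mapsto\Gamma_J(X)_n$ on graded modules, where $\Gamma_J(X)=\{x\in X: J^tx=0 \text{ for some } t\}$; the two components in the formula are regarded as modules over $R_0$ and over $R_0''$, respectively. For a Noetherian local ring $A$, an ideal $\mathfrak{q}$ primary to its maximal ideal and a finitely generated $A$-module $T$, $e_{\mathfrak{q}}(T)=d!\,c$ denotes the Hilbert-Samuel multiplicity, where $d$ is the degree and $c$ the leading coefficient of the polynomial $P$ with $P(m)=\operatorname{length}_A(T/\mathfrak{q}^{m+1}T)$ for all large $m$ (and $e_{\mathfrak{q}}(0)=0$). -/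

import Mathlib

open scoped TensorProduct

universe u

/-- A criterion for a family of submodules to be a direct sum decomposition. -/
theorem isInternal_of_proj {k V : Type*} [CommRing k] [AddCommGroup V] [Module k V]
    (W : ℤ → Submodule k V) (p : ℤ → V →ₗ[k] V) (hself : ∀ n, ∀ x ∈ W n, p n x = x)
    (hne : ∀ m n, m ≠ n → ∀ x ∈ W n, p m x = 0) (htop : ⨆ n, W n = ⊤) :
    DirectSum.IsInternal W := by
  rw [DirectSum.isInternal_submodule_iff_iSupIndep_and_iSup_eq_top]
  refine ⟨fun n => ?_, htop⟩
  rw [Submodule.disjoint_def]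
  intro x hx hx'
  have hle : (⨆ j, ⨆ (_ : j ≠ n), W j) ≤ LinearMap.ker (p n) :=
    iSup₂_le fun j hj y hy => hne n j hj.symm y hy
  rw [← hself n x hx]
  exact hle hx'

/-- A `ℤ`-graded module over the `ℕ`-graded `k`-algebra `(R, 𝒜)`. -/
structure ZGradedModule {k R : Type u} [CommRing k] [CommRing R] [Algebra k R]
    (𝒜 : ℕ → Submodule k R) where
  carrier : Type u
  [addCommGroup : AddCommGroup carrier]
  [moduleBase : Module k carrier]
  [module : Module R carrier]
  [isScalarTower : IsScalarTower k R carrier]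
  /-- The homogeneous component of degree `n`. -/
  deg : ℤ → Submodule k carrier
  isInternal : DirectSum.IsInternal deg
  smul_mem : ∀ {a : ℕ} {n : ℤ} {r : R} {x : carrier},
    r ∈ 𝒜 a → x ∈ deg n → r • x ∈ deg (a + n)

namespace ZGradedModule

section Basic

variable {k R : Type u} [CommRing k] [CommRing R] [Algebra k R] {𝒜 : ℕ → Submodule k R}

instance : CoeSort (ZGradedModule 𝒜) (Type u) := ⟨carrier⟩

attribute [instance] addCommGroup moduleBase module isScalarTower

/-- An `R`-linear map is graded if it preserves degrees. -/
def IsGradedMap {X Y : ZGradedModule 𝒜} (f : X →ₗ[R] Y) : Prop :=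
  ∀ n, ∀ x ∈ X.deg n, f x ∈ Y.deg n

/-- `E` is an injective object of the category of graded `R`-modules and graded maps. -/
def IsGradedInjective (E : ZGradedModule 𝒜) : Prop :=
  ∀ (X Y : ZGradedModule 𝒜) (j : X →ₗ[R] Y) (φ : X →ₗ[R] E),
    IsGradedMap j → Function.Injective j → IsGradedMap φ →
      ∃ ψ : Y →ₗ[R] E, IsGradedMap ψ ∧ ψ ∘ₗ j = φ

/-- An injective resolution `0 → M → E⁰ → E¹ → ⋯` in the category of graded `R`-modules. -/
structure InjectiveResolution (M : ZGradedModule 𝒜) where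
  obj : ℕ → ZGradedModule 𝒜
  injective : ∀ i, (obj i).IsGradedInjective
  ι : M →ₗ[R] obj 0
  ι_graded : IsGradedMap ι
  ι_injective : Function.Injective ι
  d : ∀ i, obj i →ₗ[R] obj (i + 1)
  d_graded : ∀ i, IsGradedMap (d i)
  exact_zero : Function.Exact ι (d 0)
  exact_succ : ∀ i, Function.Exact (d i) (d (i + 1))

/-- The degree `n` component of the `J`-torsion module `Γ_J(X) = {x | ∃ t, J ^ t • x = 0}`. -/
def torsionDeg (J : Ideal R) (X : ZGradedModule 𝒜) (n : ℤ) : Submodule k X where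
  carrier := {x | x ∈ X.deg n ∧ ∃ t : ℕ, ∀ r ∈ J ^ t, r • x = 0}
  zero_mem' := ⟨zero_mem _, 0, fun r _ => smul_zero r⟩
  add_mem' := by
    rintro x y ⟨hx, s, hs⟩ ⟨hy, t, ht⟩
    refine ⟨add_mem hx hy, s + t, fun r hr => ?_⟩
    rw [smul_add, hs r (Ideal.pow_le_pow_right (Nat.le_add_right s t) hr),
      ht r (Ideal.pow_le_pow_right (Nat.le_add_left t s) hr), add_zero]
  smul_mem' := by
    rintro c x ⟨hx, t, ht⟩
    refine ⟨Submodule.smul_mem _ c hx, t, fun r hr => ?_⟩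
    rw [← algebraMap_smul R c x, smul_comm, ht r hr, smul_zero]

namespace InjectiveResolution

variable {M : ZGradedModule 𝒜} (E : InjectiveResolution M) (J : Ideal R)

/-- The cocycles of the complex `Γ_J(E)ₙ` of `k`-modules. -/
def cocycles (i : ℕ) (n : ℤ) : Submodule k (E.obj i) :=
  torsionDeg J (E.obj i) n ⊓ LinearMap.ker ((E.d i).restrictScalars k)

/-- The coboundaries of the complex `Γ_J(E)ₙ` of `k`-modules. -/
def coboundaries : (i : ℕ) → (n : ℤ) → Submodule k (E.obj i)
  | 0, _ => ⊥
  | i + 1, n => (torsionDeg J (E.obj i) n).map ((E.d i).restrictScalars k)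

/-- The `i`-th cohomology of the complex `Γ_J(E)ₙ` of `k`-modules. -/
abbrev cohomology (i : ℕ) (n : ℤ) : Type u :=
  E.cocycles J i n ⧸ (E.coboundaries J i n).submoduleOf (E.cocycles J i n)

end InjectiveResolution

/-- The decomposition of an element into its homogeneous components. -/
noncomputable def decomp (X : ZGradedModule 𝒜) : X ≃ₗ[k] DirectSum ℤ fun n => X.deg n :=
  (LinearEquiv.ofBijective (DirectSum.coeLinearMap X.deg)
    (show Function.Bijective (DirectSum.coeLinearMap X.deg) from X.isInternal)).symm

theorem decomp_of_mem (X : ZGradedModule 𝒜) (n : ℤ) (x : X) (hx : x ∈ X.deg n) :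
    X.decomp x = DirectSum.lof k ℤ (fun n => X.deg n) n ⟨x, hx⟩ := by
  refine (LinearEquiv.symm_apply_eq _).2 ?_
  exact (DirectSum.coeLinearMap_lof X.deg n ⟨x, hx⟩).symm

/-- The projection onto the component of degree `n`. -/
noncomputable def proj (X : ZGradedModule 𝒜) (n : ℤ) : X →ₗ[k] X :=
  (X.deg n).subtype ∘ₗ DirectSum.component k ℤ (fun n => X.deg n) n ∘ₗ X.decomp.toLinearMap

theorem proj_self (X : ZGradedModule 𝒜) (n : ℤ) (x : X) (hx : x ∈ X.deg n) : X.proj n x = x := by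
  simp only [proj, LinearMap.comp_apply, LinearEquiv.coe_coe, X.decomp_of_mem n x hx,
    DirectSum.component.lof_self, Submodule.subtype_apply]

theorem proj_ne (X : ZGradedModule 𝒜) (m n : ℤ) (hmn : m ≠ n) (x : X) (hx : x ∈ X.deg n) :
    X.proj m x = 0 := by
  simp only [proj, LinearMap.comp_apply, LinearEquiv.coe_coe, X.decomp_of_mem n x hx,
    DirectSum.component.of]
  rw [dif_neg hmn.symm, map_zero]

theorem proj_mem (X : ZGradedModule 𝒜) (n : ℤ) (x : X) : X.proj n x ∈ X.deg n :=
  Subtype.prop _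

theorem iSup_deg (X : ZGradedModule 𝒜) : ⨆ n, X.deg n = ⊤ :=
  X.isInternal.submodule_iSup_eq_top

theorem iSup_map_deg {V : Type*} [AddCommGroup V] [Module k V] (X : ZGradedModule 𝒜)
    (π : X →ₗ[k] V) (hπ : Function.Surjective π) : ⨆ n, (X.deg n).map π = ⊤ := by
  rw [← Submodule.map_iSup, iSup_deg, Submodule.map_top, LinearMap.range_eq_top]
  exact hπ

/-- Two `k`-linear maps that agree on homogeneous elements are equal. -/
theorem hom_ext {V : Type*} [AddCommGroup V] [Module k V] (X : ZGradedModule 𝒜)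
    (f g : X →ₗ[k] V) (h : ∀ n, ∀ x ∈ X.deg n, f x = g x) (x : X) : f x = g x := by
  have hle : (⨆ n, X.deg n) ≤ LinearMap.eqLocus f g := iSup_le fun n y hy => h n y hy
  rw [iSup_deg] at hle
  exact hle trivial

/-- A `k`-linear endomorphism that preserves the kernel of a surjection descends. -/
theorem exists_descent {V Q : Type*} [AddCommGroup V] [Module k V] [AddCommGroup Q] [Module k Q]
    (π : V →ₗ[k] Q) (hπ : Function.Surjective π) (g : V →ₗ[k] V)
    (hg : ∀ x, π x = 0 → π (g x) = 0) : ∃ p : Q →ₗ[k] Q, ∀ x, p (π x) = π (g x) := by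
  have hle : LinearMap.ker π ≤ LinearMap.ker (π ∘ₗ g) := fun x hx => hg x hx
  refine ⟨(LinearMap.ker π).liftQ (π ∘ₗ g) hle ∘ₗ
    (π.quotKerEquivOfSurjective hπ).symm.toLinearMap, fun x => ?_⟩
  have hx : (π.quotKerEquivOfSurjective hπ).symm (π x) = (LinearMap.ker π).mkQ x := by
    rw [LinearEquiv.symm_apply_eq]
    rfl
  rw [LinearMap.comp_apply, LinearEquiv.coe_coe, hx, Submodule.mkQ_apply, Submodule.liftQ_apply,
    LinearMap.comp_apply]

/-- The image of a graded module under a surjection whose kernel is a graded submodule. -/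
def ofSurjective (Y : ZGradedModule 𝒜) (Q : Type u) [AddCommGroup Q] [Module k Q] [Module R Q]
    [IsScalarTower k R Q] (π : Y →ₗ[R] Q) (hπ : Function.Surjective π)
    (hker : ∀ y, π y = 0 → ∀ n, π (Y.proj n y) = 0) : ZGradedModule 𝒜 where
  carrier := Q
  deg n := (Y.deg n).map (π.restrictScalars k)
  isInternal := by
    choose p hp using fun n => exists_descent (π.restrictScalars k) hπ (Y.proj n)
      (fun y hy => hker y hy n)
    refine isInternal_of_proj _ p ?_ ?_ (Y.iSup_map_deg _ hπ)
    · rintro n _ ⟨y, hy, rfl⟩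
      rw [hp, Y.proj_self n y hy]
    · rintro m n hmn _ ⟨y, hy, rfl⟩
      rw [hp, Y.proj_ne m n hmn y hy, map_zero]
  smul_mem := by
    rintro a n r _ hr ⟨y, hy, rfl⟩
    exact ⟨r • y, Y.smul_mem hr hy, map_smul π r y⟩

theorem proj_map {X Y : ZGradedModule 𝒜} (f : X →ₗ[R] Y) (hf : IsGradedMap f) (n : ℤ) (x : X) :
    Y.proj n (f x) = f (X.proj n x) := by
  refine X.hom_ext (Y.proj n ∘ₗ f.restrictScalars k) (f.restrictScalars k ∘ₗ X.proj n) ?_ x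
  intro m y hy
  by_cases hnm : n = m
  · subst hnm
    simp [X.proj_self n y hy, Y.proj_self n _ (hf n y hy)]
  · simp [X.proj_ne n m hnm y hy, Y.proj_ne n m hnm _ (hf m y hy)]

/-- The cokernel of a graded map. -/
def coker {X Y : ZGradedModule 𝒜} (f : X →ₗ[R] Y) (hf : IsGradedMap f) : ZGradedModule 𝒜 :=
  Y.ofSurjective (Y ⧸ LinearMap.range f) (LinearMap.range f).mkQ (Submodule.mkQ_surjective _) (by
    intro y hy n
    rw [Submodule.mkQ_apply, Submodule.Quotient.mk_eq_zero] at hy ⊢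
    obtain ⟨x, rfl⟩ := hy
    exact ⟨X.proj n x, (proj_map f hf n x).symm⟩)

/-- The projection onto the cokernel. -/
def cokerMap {X Y : ZGradedModule 𝒜} (f : X →ₗ[R] Y) (hf : IsGradedMap f) :
    Y →ₗ[R] coker f hf := (LinearMap.range f).mkQ

theorem cokerMap_graded {X Y : ZGradedModule 𝒜} (f : X →ₗ[R] Y) (hf : IsGradedMap f) :
    IsGradedMap (cokerMap f hf) := fun _ y hy => ⟨y, hy, rfl⟩

theorem cokerMap_exact {X Y : ZGradedModule 𝒜} (f : X →ₗ[R] Y) (hf : IsGradedMap f) :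
    Function.Exact f (cokerMap f hf) := LinearMap.exact_map_mkQ_range f

theorem cokerMap_surjective {X Y : ZGradedModule 𝒜} (f : X →ₗ[R] Y) (hf : IsGradedMap f) :
    Function.Surjective (cokerMap f hf) := Submodule.mkQ_surjective _

end Basic

section Coinduced

variable {k R : Type u} [CommRing k] [CommRing R] [Algebra k R] (𝒜 : ℕ → Submodule k R)
variable (N : Type u) [AddCommGroup N] [Module k N]

/-- The module `N[T, T⁻¹]`, on which `r` of degree `a` acts as multiplication by `r T ^ a`. -/
@[nolint unusedArguments]
def Laurent (_𝒜 : ℕ → Submodule k R) (N : Type u) [AddCommGroup N] : Type u := ℤ →₀ N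

noncomputable instance : AddCommGroup (Laurent 𝒜 N) := inferInstanceAs (AddCommGroup (ℤ →₀ N))

noncomputable instance : Module k (Laurent 𝒜 N) := inferInstanceAs (Module k (ℤ →₀ N))

/-- The monomial `x T ^ n`. -/
noncomputable def Laurent.mono (n : ℤ) : N →ₗ[k] Laurent 𝒜 N := Finsupp.lsingle n

/-- The coefficient of `T ^ n`. -/
noncomputable def Laurent.coeff (n : ℤ) : Laurent 𝒜 N →ₗ[k] N := Finsupp.lapply n

/-- Evaluation at `T = 1`. -/
noncomputable def Laurent.eval : Laurent 𝒜 N →ₗ[k] N := Finsupp.lsum k fun _ => LinearMap.id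

variable {𝒜 N} in
theorem Laurent.hom_ext {V : Type*} [AddCommGroup V] [Module k V] {f g : Laurent 𝒜 N →ₗ[k] V}
    (h : ∀ n x, f (Laurent.mono 𝒜 N n x) = g (Laurent.mono 𝒜 N n x)) : f = g :=
  Finsupp.lhom_ext h

theorem Laurent.eval_mono (n : ℤ) (x : N) : eval 𝒜 N (mono 𝒜 N n x) = x := by
  exact (Finsupp.lsum_single k (fun _ : ℤ => (LinearMap.id : N →ₗ[k] N)) n x).trans rfl

theorem Laurent.coeff_mono_self (n : ℤ) (x : N) : coeff 𝒜 N n (mono 𝒜 N n x) = x := by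
  exact Finsupp.single_eq_same

theorem Laurent.coeff_mono_ne (m n : ℤ) (h : m ≠ n) (x : N) :
    coeff 𝒜 N m (mono 𝒜 N n x) = 0 := by
  exact Finsupp.single_eq_of_ne h

theorem Laurent.iSup_range : ⨆ n, LinearMap.range (mono 𝒜 N n) = ⊤ :=
  Finsupp.iSup_lsingle_range (R := k) (M := N)

variable [Module R N] [IsScalarTower k R N]

/-- The action of an element `r`, regarded as an element of degree `a`. -/
noncomputable def Laurent.actElt (a : ℕ) (r : R) : Module.End k (Laurent 𝒜 N) :=
  Finsupp.lsum k fun n => Laurent.mono 𝒜 N (a + n) ∘ₗ Module.toModuleEnd k (S := R) N r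

theorem Laurent.actElt_mono (a : ℕ) (r : R) (n : ℤ) (x : N) :
    actElt 𝒜 N a r (mono 𝒜 N n x) = mono 𝒜 N (a + n) (r • x) :=
  (Finsupp.lsum_single k (fun n : ℤ =>
    Laurent.mono 𝒜 N (a + n) ∘ₗ Module.toModuleEnd k (S := R) N r) n x).trans rfl

/-- The action of the elements of degree `a`. -/
noncomputable def Laurent.act (a : ℕ) : 𝒜 a →ₗ[k] Module.End k (Laurent 𝒜 N) where
  toFun r := actElt 𝒜 N a r
  map_add' r s := Laurent.hom_ext fun n x => by
    rw [LinearMap.add_apply, actElt_mono, actElt_mono, actElt_mono, ← map_add, ← add_smul,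
      Submodule.coe_add]
  map_smul' c r := Laurent.hom_ext fun n x => by
    rw [RingHom.id_apply, LinearMap.smul_apply, actElt_mono, actElt_mono, ← map_smul,
      Submodule.coe_smul, smul_assoc]

theorem Laurent.act_mono (a : ℕ) (r : 𝒜 a) (n : ℤ) (x : N) :
    act 𝒜 N a r (mono 𝒜 N n x) = mono 𝒜 N (a + n) ((r : R) • x) :=
  actElt_mono 𝒜 N a r n x

variable [GradedAlgebra 𝒜]

theorem Laurent.act_one :
    act 𝒜 N 0 (GradedMonoid.GOne.one (A := fun a => 𝒜 a)) = 1 := Laurent.hom_ext fun n x => by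
  rw [act_mono]
  simp

theorem Laurent.act_mul {a b : ℕ} (r : 𝒜 a) (s : 𝒜 b) :
    act 𝒜 N (a + b) (GradedMonoid.GMul.mul (A := fun a => 𝒜 a) r s) = act 𝒜 N a r * act 𝒜 N b s :=
  Laurent.hom_ext fun n x => by
    rw [Module.End.mul_apply, act_mono, act_mono, act_mono]
    simp [mul_smul, add_assoc]

/-- The action of `R` on `N[T, T⁻¹]`. -/
noncomputable def Laurent.actHom : R →ₐ[k] Module.End k (Laurent 𝒜 N) :=
  (DirectSum.toAlgebra k (fun a => 𝒜 a) (Laurent.act 𝒜 N) (act_one 𝒜 N) (act_mul 𝒜 N)).comp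
    (DirectSum.decomposeAlgEquiv 𝒜).toAlgHom

noncomputable instance : Module R (Laurent 𝒜 N) :=
  Module.compHom (Laurent 𝒜 N) (Laurent.actHom 𝒜 N).toRingHom

theorem Laurent.smul_def (r : R) (x : Laurent 𝒜 N) : r • x = actHom 𝒜 N r x := rfl

theorem Laurent.smul_mono {a : ℕ} {r : R} (hr : r ∈ 𝒜 a) (n : ℤ) (x : N) :
    r • mono 𝒜 N n x = mono 𝒜 N (a + n) (r • x) := by
  rw [smul_def]
  lift r to 𝒜 a using hr
  refine Eq.trans (congrArg (fun g : Module.End k (Laurent 𝒜 N) => g (mono 𝒜 N n x)) ?_)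
    (act_mono 𝒜 N a r n x)
  change DirectSum.toAlgebra k (fun a => 𝒜 a) (act 𝒜 N) (act_one 𝒜 N) (act_mul 𝒜 N) (DirectSum.decompose 𝒜 (r : R)) = _
  rw [DirectSum.decompose_coe]
  exact DirectSum.toSemiring_of (fun a => (act 𝒜 N a).toAddMonoidHom) (act_one 𝒜 N)
    (act_mul 𝒜 N) a r

instance : IsScalarTower k R (Laurent 𝒜 N) where
  smul_assoc c r x := by
    rw [Laurent.smul_def, Laurent.smul_def, map_smul, LinearMap.smul_apply]

/-- The graded module `N[T, T⁻¹]`. -/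
noncomputable def coinduced : ZGradedModule 𝒜 where
  carrier := Laurent 𝒜 N
  deg n := LinearMap.range (Laurent.mono 𝒜 N n)
  isInternal := by
    refine isInternal_of_proj _ (fun n => Laurent.mono 𝒜 N n ∘ₗ Laurent.coeff 𝒜 N n) ?_ ?_
      (Laurent.iSup_range 𝒜 N)
    · rintro n _ ⟨x, rfl⟩
      simp [Laurent.coeff_mono_self]
    · rintro m n hmn _ ⟨x, rfl⟩
      simp [Laurent.coeff_mono_ne 𝒜 N m n hmn]
  smul_mem := by
    rintro a n r _ hr ⟨x, rfl⟩
    exact ⟨r • x, (Laurent.smul_mono 𝒜 N hr n x).symm⟩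

variable {𝒜 N}

/-- Additive induction on the homogeneous components of a ring element. -/
theorem ring_induction {P : R → Prop} (h0 : P 0) (hadd : ∀ r s, P r → P s → P (r + s))
    (hhom : ∀ a, ∀ r ∈ 𝒜 a, P r) (r : R) : P r :=
  DirectSum.Decomposition.inductionOn 𝒜 h0 (fun {a} r => hhom a r r.2) hadd r

/-- Evaluation at `T = 1` is `R`-linear. -/
noncomputable def evalHomAux : Laurent 𝒜 N →ₗ[R] N where
  toFun := Laurent.eval 𝒜 N
  map_add' := map_add _
  map_smul' r x := by
    refine ring_induction (𝒜 := 𝒜) (P := fun r => Laurent.eval 𝒜 N (r • x) =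
      r • Laurent.eval 𝒜 N x) ?_ ?_ ?_ r
    · rw [zero_smul, zero_smul, map_zero]
    · intro r s hr hs
      rw [add_smul, add_smul, map_add, hr, hs]
    · intro a r hr
      have h : Laurent.eval 𝒜 N ∘ₗ Laurent.actHom 𝒜 N r =
          Module.toModuleEnd k (S := R) N r ∘ₗ Laurent.eval 𝒜 N := by
        refine Laurent.hom_ext fun n y => ?_
        change Laurent.eval 𝒜 N (r • Laurent.mono 𝒜 N n y) = r • Laurent.eval 𝒜 N _
        rw [Laurent.smul_mono 𝒜 N hr, Laurent.eval_mono, Laurent.eval_mono]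
      exact LinearMap.congr_fun h x

/-- Evaluation at `T = 1` on the graded module `N[T, T⁻¹]`. -/
noncomputable def evalHom : coinduced 𝒜 N →ₗ[R] N := evalHomAux

/-- The map `x ↦ ∑ₙ h(xₙ) T ^ n`, as a `k`-linear map. -/
noncomputable def liftAux {X : ZGradedModule 𝒜} (h : X →ₗ[R] N) : X →ₗ[k] Laurent 𝒜 N :=
  DirectSum.toModule k ℤ (Laurent 𝒜 N)
      (fun n => Laurent.mono 𝒜 N n ∘ₗ h.restrictScalars k ∘ₗ (X.deg n).subtype) ∘ₗ
    X.decomp.toLinearMap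

theorem liftAux_of_mem {X : ZGradedModule 𝒜} (h : X →ₗ[R] N) (n : ℤ) (x : X)
    (hx : x ∈ X.deg n) : liftAux h x = Laurent.mono 𝒜 N n (h x) := by
  simp only [liftAux, LinearMap.comp_apply, LinearEquiv.coe_coe, X.decomp_of_mem n x hx,
    DirectSum.toModule_lof, Submodule.subtype_apply, LinearMap.restrictScalars_apply]

/-- The graded map `x ↦ ∑ₙ h(xₙ) T ^ n` into `N[T, T⁻¹]` given by an `R`-linear map `h`. -/
noncomputable def lift {X : ZGradedModule 𝒜} (h : X →ₗ[R] N) : X →ₗ[R] coinduced 𝒜 N where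
  toFun := liftAux h
  map_add' := map_add _
  map_smul' r x := by
    refine ring_induction (𝒜 := 𝒜) (P := fun r => liftAux h (r • x) = r • liftAux h x) ?_ ?_ ?_ r
    · rw [zero_smul, zero_smul, map_zero]
    · intro r s hr hs
      rw [add_smul, add_smul, map_add, hr, hs]
    · intro a r hr
      refine X.hom_ext (liftAux h ∘ₗ Module.toModuleEnd k (S := R) X r)
        (Laurent.actHom 𝒜 N r ∘ₗ liftAux h) ?_ x
      intro n y hy
      change liftAux h (r • y) = r • liftAux h y
      rw [liftAux_of_mem h n y hy, liftAux_of_mem h _ _ (X.smul_mem hr hy),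
        Laurent.smul_mono 𝒜 N hr, map_smul]

theorem lift_of_mem {X : ZGradedModule 𝒜} (h : X →ₗ[R] N) (n : ℤ) (x : X)
    (hx : x ∈ X.deg n) : lift h x = Laurent.mono 𝒜 N n (h x) :=
  liftAux_of_mem h n x hx

theorem lift_graded {X : ZGradedModule 𝒜} (h : X →ₗ[R] N) : IsGradedMap (lift h) :=
  fun n x hx => ⟨h x, (lift_of_mem h n x hx).symm⟩

theorem evalHom_lift {X : ZGradedModule 𝒜} (h : X →ₗ[R] N) (x : X) : evalHom (lift h x) = h x := by
  refine X.hom_ext (Laurent.eval 𝒜 N ∘ₗ liftAux h) (h.restrictScalars k) ?_ x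
  intro n y hy
  change Laurent.eval 𝒜 N (liftAux h y) = h y
  rw [liftAux_of_mem h n y hy, Laurent.eval_mono]

theorem lift_injective {X : ZGradedModule 𝒜} (h : X →ₗ[R] N) (hh : Function.Injective h) :
    Function.Injective (lift h) := fun x y hxy => hh <| by
  rw [← evalHom_lift h x, hxy, evalHom_lift]

theorem coinduced_injective [Module.Injective R N] : (coinduced 𝒜 N).IsGradedInjective := by
  intro X Y j φ hj hj' hφ
  obtain ⟨ψ, hψ⟩ := Module.Injective.out j hj' (evalHom ∘ₗ φ)
  refine ⟨lift ψ, lift_graded ψ, LinearMap.ext fun x => ?_⟩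
  refine X.hom_ext ((lift ψ ∘ₗ j).restrictScalars k) (φ.restrictScalars k) ?_ x
  intro n y hy
  change lift ψ (j y) = φ y
  obtain ⟨z, hz⟩ := hφ n y hy
  rw [lift_of_mem ψ n _ (hj n y hy), hψ y, ← hz]
  change Laurent.mono 𝒜 N n (evalHom (φ y)) = _
  rw [← hz]
  exact congrArg _ (Laurent.eval_mono 𝒜 N n z)

end Coinduced

section LocalCohomology

variable {k R : Type u} [CommRing k] [CommRing R] [Algebra k R] {𝒜 : ℕ → Submodule k R}
  [GradedAlgebra 𝒜]

theorem exists_injective_embedding (X : ZGradedModule 𝒜) :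
    ∃ (E : ZGradedModule 𝒜) (f : X →ₗ[R] E),
      E.IsGradedInjective ∧ IsGradedMap f ∧ Function.Injective f := by
  obtain ⟨⟨I, hI, f, hf⟩⟩ :=
    (inferInstance : CategoryTheory.EnoughInjectives (ModuleCat.{u} R)).presentation
      (ModuleCat.of R X)
  have hinj : Module.Injective R I := Module.injective_module_of_injective_object R I
  let _ : Module k I := Module.compHom I (algebraMap k R)
  have : IsScalarTower k R I := .of_algebraMap_smul fun _ _ => rfl
  exact ⟨coinduced 𝒜 I, lift f.hom, coinduced_injective, lift_graded _,
    lift_injective _ ((ModuleCat.mono_iff_injective f).1 hf)⟩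

/-- Every graded module has a graded injective resolution. -/
theorem nonempty_injectiveResolution (M : ZGradedModule 𝒜) :
    Nonempty (InjectiveResolution M) := by
  choose E f hE hf hf' using exists_injective_embedding (𝒜 := 𝒜)
  let X : ℕ → ZGradedModule 𝒜 := fun i => Nat.rec M (fun _ Y => coker (f Y) (hf Y)) i
  let π : ∀ i, E (X i) →ₗ[R] X (i + 1) := fun i => cokerMap (f (X i)) (hf (X i))
  have hπ : ∀ i, Function.Exact (f (X i)) (π i) := fun i => cokerMap_exact (f (X i)) (hf (X i))
  have hπs : ∀ i, Function.Surjective (π i) := fun i => cokerMap_surjective (f (X i)) (hf (X i))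
  have hex : ∀ i, Function.Exact (f (X i)) (f (X (i + 1)) ∘ₗ π i) := fun i x => by
    rw [← hπ i x, LinearMap.comp_apply, map_eq_zero_iff _ (hf' _)]
  exact ⟨{
    obj := fun i => E (X i)
    injective := fun i => hE _
    ι := f M
    ι_graded := hf M
    ι_injective := hf' M
    d := fun i => f (X (i + 1)) ∘ₗ π i
    d_graded := fun i n x hx => hf (X (i + 1)) n _ (cokerMap_graded (f (X i)) (hf (X i)) n x hx)
    exact_zero := hex 0
    exact_succ := fun i x => by
      rw [hex (i + 1) x]
      constructor
      · rintro ⟨y, rfl⟩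
        obtain ⟨z, rfl⟩ := hπs i y
        exact ⟨z, rfl⟩
      · rintro ⟨z, rfl⟩
        exact ⟨π i z, rfl⟩ }⟩

/-- The component `H^i_J(M)ₙ` of degree `n` of the `i`-th local cohomology module of the graded
module `M` with respect to the homogeneous ideal `J`: the value at `M` of the `i`-th right derived
functor of `Γ_J(-)ₙ` on graded modules, computed from an injective resolution. -/
abbrev localCohomology (M : ZGradedModule 𝒜) (J : Ideal R) (i : ℕ) (n : ℤ) : Type u :=
  (Classical.choice M.nonempty_injectiveResolution).cohomology J i n

end LocalCohomology

section BaseChange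

variable {k R : Type u} [CommRing k] [CommRing R] [Algebra k R]
variable (A : Type u) [CommRing A] [Algebra A k] [Algebra A R] [IsScalarTower A k R]
variable (S : Type u) [CommRing S] [Algebra A S]

/-- The grading of `S ⊗[A] R` whose component of degree `a` is the image of `S ⊗[A] 𝒜 a`. -/
def baseChangeGrading (𝒜 : ℕ → Submodule k R) (a : ℕ) : Submodule S (S ⊗[A] R) :=
  ((𝒜 a).restrictScalars A).baseChange S

noncomputable instance (𝒜 : ℕ → Submodule k R) [GradedAlgebra 𝒜] :
    GradedAlgebra (fun a => (𝒜 a).restrictScalars A) where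
  one_mem := SetLike.GradedOne.one_mem (A := 𝒜)
  mul_mem _ _ _ _ h h' := SetLike.GradedMul.mul_mem (A := 𝒜) h h'
  decompose' := DirectSum.Decomposition.decompose' (ℳ := 𝒜)
  left_inv := DirectSum.Decomposition.left_inv (ℳ := 𝒜)
  right_inv := DirectSum.Decomposition.right_inv (ℳ := 𝒜)

noncomputable instance (𝒜 : ℕ → Submodule k R) [GradedAlgebra 𝒜] :
    GradedAlgebra (baseChangeGrading A S 𝒜) :=
  GradedAlgebra.baseChange (S := S) (fun a => (𝒜 a).restrictScalars A)

/-- The action of `S ⊗[A] R` on `S ⊗[A] X` given by `(s ⊗ r) • (t ⊗ x) = s t ⊗ r x`. -/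
noncomputable def tensorAction (X : Type u) [AddCommGroup X] [Module A X] [Module R X]
    [IsScalarTower A R X] : S ⊗[A] R →ₐ[S] Module.End S (S ⊗[A] X) :=
  AlgHom.liftEquiv A S R _ ((Module.End.baseChangeHom A S X).comp (Algebra.lsmul A A X))

theorem tensorAction_tmul (X : Type u) [AddCommGroup X] [Module A X] [Module R X]
    [IsScalarTower A R X] (s t : S) (r : R) (x : X) :
    tensorAction A S X (s ⊗ₜ r) (t ⊗ₜ x) = (s * t) ⊗ₜ (r • x) := by
  rfl

/-- The graded `S ⊗[A] R`-module `S ⊗[A] X` obtained from the graded `R`-module `X`. -/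
noncomputable def baseChange {𝒜 : ℕ → Submodule k R} (X : ZGradedModule 𝒜) [Module A X]
    [IsScalarTower A k X] : ZGradedModule (baseChangeGrading A S 𝒜) :=
  haveI : IsScalarTower A R X := .of_algebraMap_smul fun c x => by
    rw [IsScalarTower.algebraMap_apply A k R, algebraMap_smul, algebraMap_smul]
  letI : Module (S ⊗[A] R) (S ⊗[A] X) :=
    Module.compHom (S ⊗[A] X) (tensorAction A S X).toRingHom
  { carrier := S ⊗[A] X
    isScalarTower := ⟨fun c r x => by
      change tensorAction A S X (c • r) x = c • tensorAction A S X r x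
      rw [map_smul, LinearMap.smul_apply]⟩
    deg := fun n => ((X.deg n).restrictScalars A).baseChange S
    isInternal := by
      refine isInternal_of_proj _
        (fun n => ((X.proj n).restrictScalars A).baseChange S) ?_ ?_ ?_
      · intro n x hx
        rw [Submodule.baseChange_eq_span] at hx
        induction hx using Submodule.span_induction with
        | mem x h =>
          obtain ⟨y, hy, rfl⟩ := h
          simp [X.proj_self n y hy]
        | zero => simp
        | add x y _ _ hx hy => rw [map_add, hx, hy]
        | smul c x _ hx => rw [map_smul, hx]
      · intro m n hmn x hx
        rw [Submodule.baseChange_eq_span] at hx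
        induction hx using Submodule.span_induction with
        | mem x h =>
          obtain ⟨y, hy, rfl⟩ := h
          simp [X.proj_ne m n hmn y hy]
        | zero => simp
        | add x y _ _ hx hy => rw [map_add, hx, hy, add_zero]
        | smul c x _ hx => rw [map_smul, hx, smul_zero]
      · rw [eq_top_iff]
        rintro x -
        induction x using TensorProduct.induction_on with
        | zero => exact zero_mem _
        | add x y hx hy => exact add_mem hx hy
        | tmul s x =>
          have hx : x ∈ ⨆ n, X.deg n := by rw [X.iSup_deg]; trivial
          induction hx using Submodule.iSup_induction' with
          | mem n x hx =>
            exact Submodule.mem_iSup_of_mem n (Submodule.tmul_mem_baseChange_of_mem s hx)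
          | zero => simp
          | add x y _ _ hx hy =>
            rw [TensorProduct.tmul_add]
            exact add_mem hx hy
    smul_mem := by
      intro a n r x hr hx
      change tensorAction A S X r x ∈ _
      rw [baseChangeGrading, Submodule.baseChange_eq_span] at hr
      rw [Submodule.baseChange_eq_span] at hx
      induction hr using Submodule.span_induction with
      | mem r h =>
        obtain ⟨r, hr, rfl⟩ := h
        induction hx using Submodule.span_induction with
        | mem x h =>
          obtain ⟨x, hx, rfl⟩ := h
          have h := tensorAction_tmul A S X 1 1 r x
          simp only [TensorProduct.mk_apply] at h ⊢
          rw [h]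
          exact Submodule.tmul_mem_baseChange_of_mem _ (X.smul_mem hr hx)
        | zero => rw [map_zero]; exact zero_mem _
        | add x y _ _ hx hy => rw [map_add]; exact add_mem hx hy
        | smul c x _ hx => rw [map_smul]; exact Submodule.smul_mem _ c hx
      | zero => rw [map_zero]; exact zero_mem _
      | add r s _ _ hr hs => rw [map_add]; exact add_mem hr hs
      | smul c r _ hr => rw [map_smul]; exact Submodule.smul_mem _ c hr }

end BaseChange

end ZGradedModule

section Multiplicity

variable {A : Type*} [CommRing A] (q : Ideal A) (T : Type*) [AddCommGroup T] [Module A T]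

/-- `P` is the Hilbert-Samuel polynomial of `T` with respect to `q`: the length of
`T / q ^ (m + 1) T` is finite and equal to `P(m)` for all large `m`. -/
def IsHilbertSamuelPolynomial (P : Polynomial ℚ) : Prop :=
  ∀ᶠ m : ℕ in Filter.atTop, ∃ l : ℕ,
    Module.length A (T ⧸ (q ^ (m + 1) • ⊤ : Submodule A T)) = l ∧ P.eval (m : ℚ) = l

open scoped Classical in
/-- The Hilbert-Samuel multiplicity `e_q(T) = d! c`, where `d` is the degree and `c` the leading
coefficient of the (unique) Hilbert-Samuel polynomial of `T` with respect to `q`; it is `0` for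
`T = 0`. A Hilbert-Samuel polynomial exists if `T` is finitely generated and `q` is primary to the
maximal ideal of the Noetherian local ring `A`. -/
noncomputable def hilbertSamuelMultiplicity : ℚ :=
  if h : ∃ P, IsHilbertSamuelPolynomial q T P then
    (h.choose.natDegree.factorial : ℚ) * h.choose.leadingCoeff
  else 0

end Multiplicity

/-! The heart of the matter is flat base change for graded local cohomology: the degree-`n`
component over `R₀''` is `R₀'' ⊗ H` with `H = H^i_{R_+}(M)_n`, the tensor product being over `R₀'`.
For a module `N` over `R₀'`, the length of `R₀'' ⊗ N` is the length of `N` times that of `R₀'' / 𝔪'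
R₀''`, and the latter is the residue field (`length_baseChange_quotient_smul_top`). Passing from
`R₀'` to its quotient `R₀` does not change lengths either. So the two Hilbert-Samuel functions agree
term by term, and with them the multiplicities; finite generation of the cohomology plays no role in
this comparison.

For flat base change, tensor a graded injective resolution `E` of `M` with `R₀''`. The result is a
resolution, but its terms need not be injective. They are still acyclic for torsion, in the
elementwise sense of `IsTorsionAcyclic`: for generators `f₁, …, fᵣ` of the ideal, at each stage the
torsion module `Γ` obtained so far maps onto its localization `Γ_f`. Injective modules have this
property by Artin-Rees (`IsTorsionAcyclic.of_injective`). Graded injectives inherit it as retracts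
of modules `N[T, T⁻¹]` with `N` injective. It survives flat base change, because torsion for
finitely many elements does (`mem_powTorsion_baseChange`).

Acyclic resolutions compute local cohomology (`Resolution.nonempty_cohomology_equiv`): a chain map
to an injective resolution has an exact mapping cone with acyclic terms, and torsion keeps it exact.
Finally, cocycles and coboundaries are formed by kernels, finite intersections and images, all of
which commute with flat base change. -/

/-! ### Torsion for a finite list of elements, and acyclic modules. -/

section PowTorsion

variable {R : Type*} [CommRing R]

/-- The elements that are annihilated by a power of each member of the list `l`. -/
def powTorsion (l : List R) (X : Type*) [AddCommGroup X] [Module R X] : Submodule R X where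
  carrier := {x | ∀ f ∈ l, ∃ t : ℕ, f ^ t • x = 0}
  zero_mem' := fun f _ => ⟨0, smul_zero _⟩
  add_mem' := by
    intro x y hx hy f hf
    obtain ⟨s, hs⟩ := hx f hf
    obtain ⟨t, ht⟩ := hy f hf
    refine ⟨s + t, ?_⟩
    rw [smul_add, pow_add, mul_smul, mul_smul, ht, smul_zero, smul_comm, hs, smul_zero, add_zero]
  smul_mem' := by
    intro c x hx f hf
    obtain ⟨t, ht⟩ := hx f hf
    exact ⟨t, by rw [smul_comm, ht, smul_zero]⟩

variable {X Y Z : Type*} [AddCommGroup X] [Module R X] [AddCommGroup Y] [Module R Y]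
  [AddCommGroup Z] [Module R Z]

theorem mem_powTorsion {l : List R} {x : X} :
    x ∈ powTorsion l X ↔ ∀ f ∈ l, ∃ t : ℕ, f ^ t • x = 0 := Iff.rfl

theorem powTorsion_cons {f : R} {l : List R} {x : X} :
    x ∈ powTorsion (f :: l) X ↔ (∃ t : ℕ, f ^ t • x = 0) ∧ x ∈ powTorsion l X := by
  simp [mem_powTorsion]

theorem map_mem_powTorsion {l : List R} (g : X →ₗ[R] Y) {x : X} (hx : x ∈ powTorsion l X) :
    g x ∈ powTorsion l Y := fun f hf => by
  obtain ⟨t, ht⟩ := hx f hf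
  exact ⟨t, by rw [← map_smul, ht, map_zero]⟩

theorem mem_powTorsion_of_injective {l : List R} (g : X →ₗ[R] Y) (hg : Function.Injective g)
    {x : X} (hx : g x ∈ powTorsion l Y) : x ∈ powTorsion l X := fun f hf => by
  obtain ⟨t, ht⟩ := hx f hf
  exact ⟨t, hg (by rw [map_smul, ht, map_zero])⟩

theorem mem_powTorsion_prod {l : List R} {x : X × Y} :
    x ∈ powTorsion l (X × Y) ↔ x.1 ∈ powTorsion l X ∧ x.2 ∈ powTorsion l Y := by
  refine ⟨fun h => ⟨map_mem_powTorsion (LinearMap.fst R X Y) h,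
    map_mem_powTorsion (LinearMap.snd R X Y) h⟩, fun h => ?_⟩
  have := add_mem (map_mem_powTorsion (LinearMap.inl R X Y) h.1)
    (map_mem_powTorsion (LinearMap.inr R X Y) h.2)
  simpa using this

/-- A uniform exponent for the members of `l`. -/
theorem exists_pow_of_mem_powTorsion {l : List R} {x : X} (hx : x ∈ powTorsion l X) :
    ∃ t : ℕ, ∀ f ∈ l, f ^ t • x = 0 := by
  induction l with
  | nil => exact ⟨0, by simp⟩
  | cons f l ih =>
    obtain ⟨⟨s, hs⟩, hl⟩ := powTorsion_cons.1 hx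
    obtain ⟨t, ht⟩ := ih hl
    refine ⟨s + t, fun g hg => ?_⟩
    rcases List.mem_cons.1 hg with rfl | hg
    · rw [pow_add, mul_comm, mul_smul, hs, smul_zero]
    · rw [pow_add, mul_smul, ht g hg, smul_zero]

/-- If `f ^ s` and `J ^ t` kill `x`, then so does the power `s + t` of the ideal `(f) + J`. Torsion
for an ideal can thus be handled one generator at a time. -/
theorem mem_powTorsion_iff_ofList {l : List R} {x : X} :
    x ∈ powTorsion l X ↔ ∃ t : ℕ, ∀ r ∈ Ideal.ofList l ^ t, r • x = 0 := by
  constructor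
  · intro hx
    induction l with
    -- The ideal of the empty list is zero, but its power with exponent `0` is the unit ideal, so
    -- the exponent must be at least `1`.
    | nil => exact ⟨1, fun r hr => by simp at hr; simp [hr]⟩
    | cons f l ih =>
      obtain ⟨⟨s, hs⟩, hl⟩ := powTorsion_cons.1 hx
      obtain ⟨t, ht⟩ := ih hl
      refine ⟨s + t, fun r hr => ?_⟩
      rw [Ideal.ofList_cons] at hr
      have h := Ideal.sup_pow_add_le_pow_sup_pow hr
      rw [Ideal.span_singleton_pow] at h
      obtain ⟨a, ha, b, hb, rfl⟩ := Submodule.mem_sup.1 h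
      obtain ⟨c, rfl⟩ := Ideal.mem_span_singleton'.1 ha
      rw [add_smul, mul_smul, hs, smul_zero, ht b hb, add_zero]
  · rintro ⟨t, ht⟩ f hf
    exact ⟨t, ht _ (Ideal.pow_mem_pow (Ideal.subset_span (s := {g | g ∈ l}) hf) t)⟩

/-- The elements `x` that become divisible by `f` in `U` after multiplication by a power of `f`. -/
def powDivisible (f : R) (U : Submodule R X) : Submodule R X where
  carrier := {x | ∃ k : ℕ, ∃ y ∈ U, f ^ (k + 1) • y = f ^ k • x}
  zero_mem' := ⟨0, 0, zero_mem _, by simp⟩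
  add_mem' := by
    rintro x x' ⟨k, y, hy, hk⟩ ⟨j, z, hz, hj⟩
    refine ⟨k + j, y + z, add_mem hy hz, ?_⟩
    rw [smul_add, smul_add, show f ^ (k + j + 1) • y = f ^ j • f ^ (k + 1) • y by
        rw [smul_smul, ← pow_add]; congr 2; omega,
      show f ^ (k + j + 1) • z = f ^ k • f ^ (j + 1) • z by
        rw [smul_smul, ← pow_add]; congr 2, hk, hj, smul_smul, smul_smul, ← pow_add, ← pow_add,
      add_comm j k]
  smul_mem' := by
    rintro c x ⟨k, y, hy, hk⟩
    exact ⟨k, c • y, Submodule.smul_mem _ c hy, by rw [smul_comm, hk, smul_comm]⟩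

theorem map_mem_powDivisible {f : R} {U : Submodule R X} {V : Submodule R Y} (g : X →ₗ[R] Y)
    (hg : ∀ x ∈ U, g x ∈ V) {x : X} (hx : x ∈ powDivisible f U) : g x ∈ powDivisible f V := by
  obtain ⟨k, y, hy, hk⟩ := hx
  exact ⟨k, g y, hg y hy, by rw [← map_smul, hk, map_smul]⟩

/-- For `l = [f₁, …, fᵣ]`, the iterated local cohomology modules of `X` with respect to
`fᵣ, …, f₁` vanish in positive degrees: at each step `Γ → Γ_f` is surjective. -/
def IsTorsionAcyclic : (l : List R) → (X : Type*) → [AddCommGroup X] → [Module R X] → Prop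
  | [], _, _, _ => True
  | f :: l, X, _, _ => IsTorsionAcyclic l X ∧ powTorsion l X ≤ powDivisible f (powTorsion l X)

/-- The hypothesis says that each `x / 1` in the localization `U_f` is `f` times the image of an
element of `U`. Iterating it divides by any power of `f`. -/
theorem exists_pow_smul_eq {f : R} (U : Submodule R X)
    (hU : U ≤ powDivisible f U) (m : ℕ) :
    ∀ x ∈ U, ∃ k : ℕ, ∃ y ∈ U, f ^ (k + m) • y = f ^ k • x := by
  induction m with
  | zero => exact fun x hx => ⟨0, x, hx, rfl⟩
  | succ m ih =>
    intro x hx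
    obtain ⟨k, y, hy, h⟩ := ih x hx
    obtain ⟨j, z, hz, h'⟩ := hU hy
    refine ⟨j + k, z, hz, ?_⟩
    calc f ^ (j + k + (m + 1)) • z = f ^ (k + m) • f ^ (j + 1) • z := by
          rw [smul_smul, ← pow_add]; congr 2; omega
      _ = f ^ j • f ^ (k + m) • y := by rw [h', smul_comm]
      _ = f ^ (j + k) • x := by rw [h, smul_smul, ← pow_add]

/-- Torsion is exact on short exact sequences with acyclic kernel. -/
theorem IsTorsionAcyclic.exists_lift {l : List R} (hX : IsTorsionAcyclic l X)
    (i : X →ₗ[R] Y) (p : Y →ₗ[R] Z) (hi : Function.Injective i) (hp : Function.Surjective p)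
    (h : Function.Exact i p) : ∀ z ∈ powTorsion l Z, ∃ y ∈ powTorsion l Y, p y = z := by
  induction l with
  | nil =>
    intro z _
    obtain ⟨y, rfl⟩ := hp z
    exact ⟨y, by simp [mem_powTorsion], rfl⟩
  | cons f l ih =>
    intro z hz
    obtain ⟨⟨m, hm⟩, hl⟩ := powTorsion_cons.1 hz
    obtain ⟨y, hy, rfl⟩ := ih hX.1 z hl
    -- The lift `y` is torsion for `l` but perhaps not for `f`. The defect `f ^ m • y` comes from
    -- `X`, where it can be divided by `f ^ m` up to a power of `f`; subtracting the quotient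
    -- corrects `y`.
    obtain ⟨x, hx⟩ := (h (f ^ m • y)).1 (by rw [map_smul, hm])
    have hxl : x ∈ powTorsion l X := mem_powTorsion_of_injective i hi (by
      rw [hx]; exact Submodule.smul_mem _ _ hy)
    obtain ⟨k, x', hx', hk⟩ := exists_pow_smul_eq _ hX.2 m x hxl
    refine ⟨y - i x', powTorsion_cons.2 ⟨⟨k + m, ?_⟩, sub_mem hy (map_mem_powTorsion i hx')⟩, ?_⟩
    · rw [smul_sub, ← map_smul, hk, map_smul, hx, smul_smul, ← pow_add, sub_self]
    · rw [map_sub, h.apply_apply_eq_zero, sub_zero]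

/-- Torsion elements of `Z` lift to torsion elements of `Y` because `X` is acyclic; the division by
`f` is carried out in `Y` and pushed down. -/
theorem IsTorsionAcyclic.of_exact {l : List R} (hX : IsTorsionAcyclic l X)
    (hY : IsTorsionAcyclic l Y) (i : X →ₗ[R] Y) (p : Y →ₗ[R] Z) (hi : Function.Injective i)
    (hp : Function.Surjective p) (h : Function.Exact i p) : IsTorsionAcyclic l Z := by
  induction l with
  | nil => trivial
  | cons f l ih =>
    refine ⟨ih hX.1 hY.1, fun z hz => ?_⟩
    obtain ⟨y, hy, rfl⟩ := hX.1.exists_lift i p hi hp h z hz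
    exact map_mem_powDivisible p (fun _ => map_mem_powTorsion p) (hY.2 hy)

theorem IsTorsionAcyclic.of_retract {l : List R} (hY : IsTorsionAcyclic l Y) (i : X →ₗ[R] Y)
    (p : Y →ₗ[R] X) (h : ∀ x, p (i x) = x) : IsTorsionAcyclic l X := by
  induction l with
  | nil => trivial
  | cons f l ih =>
    refine ⟨ih hY.1, fun x hx => ?_⟩
    rw [← h x]
    exact map_mem_powDivisible p (fun _ => map_mem_powTorsion p) (hY.2 (map_mem_powTorsion i hx))

theorem IsTorsionAcyclic.of_equiv {l : List R} (hX : IsTorsionAcyclic l X) (e : X ≃ₗ[R] Y) :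
    IsTorsionAcyclic l Y :=
  hX.of_retract e.symm.toLinearMap e.toLinearMap (fun y => e.apply_symm_apply y)

theorem IsTorsionAcyclic.prod {l : List R} (hX : IsTorsionAcyclic l X)
    (hY : IsTorsionAcyclic l Y) : IsTorsionAcyclic l (X × Y) := by
  induction l with
  | nil => trivial
  | cons f l ih =>
    refine ⟨ih hX.1 hY.1, fun x hx => ?_⟩
    obtain ⟨hx₁, hx₂⟩ := mem_powTorsion_prod.1 hx
    have := add_mem
      (map_mem_powDivisible (LinearMap.inl R X Y) (fun _ => map_mem_powTorsion _) (hX.2 hx₁))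
      (map_mem_powDivisible (LinearMap.inr R X Y) (fun _ => map_mem_powTorsion _) (hY.2 hx₂))
    simpa using this

/-- Injective modules over Noetherian rings are acyclic for torsion. -/
theorem IsTorsionAcyclic.of_injective {R : Type u} [CommRing R] [IsNoetherianRing R] (l : List R)
    (N : Type u) [AddCommGroup N] [Module R N] [Module.Injective R N] :
    IsTorsionAcyclic l N := by
  induction l with
  | nil => trivial
  | cons f l ih =>
    refine ⟨ih, fun x hx => ?_⟩
    obtain ⟨t, ht⟩ := mem_powTorsion_iff_ofList.1 hx
    set a := Ideal.ofList l
    -- The annihilators of the powers of `f` form an ascending chain of ideals, which stabilizes at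
    -- some `k`.
    obtain ⟨k, hk⟩ : ∃ k : ℕ, ∀ r : R, f ^ (k + 1) * r = 0 → f ^ k * r = 0 := by
      let c : ℕ →o Ideal R := ⟨fun k => LinearMap.ker (LinearMap.mulLeft R (f ^ k)), by
        refine monotone_nat_of_le_succ fun k r hr => ?_
        simp only [LinearMap.mem_ker, LinearMap.mulLeft_apply] at hr ⊢
        rw [pow_succ', mul_assoc, hr, mul_zero]⟩
      obtain ⟨k, hk⟩ := monotone_stabilizes_iff_noetherian.2 ‹IsNoetherianRing R› c
      refine ⟨k, fun r hr => ?_⟩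
      have h : r ∈ c (k + 1) := by simpa [c] using hr
      rw [← hk (k + 1) (Nat.le_succ k)] at h
      simpa [c] using h
    -- Artin-Rees: an element of `(f ^ (k + 1))` in `a ^ (t + c)` is `f ^ (k + 1) * b` with `b ∈ a ^
    -- t`, and such `b` kills `x`. This makes the map extended below well defined.
    obtain ⟨c, hc⟩ := Ideal.exists_pow_inf_eq_pow_smul (M := R) a (Ideal.span {f ^ (k + 1)})
    have key : ∀ r : R, f ^ (k + 1) * r ∈ a ^ (t + c) → (f ^ k * r) • x = 0 := by
      intro r hr
      have h : f ^ (k + 1) * r ∈ (a ^ (t + c) • ⊤ : Ideal R) ⊓ Ideal.span {f ^ (k + 1)} := by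
        refine ⟨by simpa using hr, Ideal.mem_span_singleton.2 (dvd_mul_right _ _)⟩
      rw [hc (t + c) (by omega), Nat.add_sub_cancel] at h
      have h' : f ^ (k + 1) * r ∈ a ^ t * Ideal.span {f ^ (k + 1)} :=
        Ideal.mul_mono_right inf_le_right h
      obtain ⟨b, hb, hbr⟩ := Ideal.mem_mul_span_singleton.1 h'
      have hz := hk (r - b) (by rw [mul_sub, ← hbr]; ring)
      rw [mul_sub, sub_eq_zero] at hz
      rw [hz, mul_smul, ht b hb, smul_zero]
    -- extend `f ^ (k + 1) * r ↦ f ^ k * r * x` from the image of `f ^ (k + 1)` in `R / a ^ (t + c)`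
    let Q := R ⧸ a ^ (t + c)
    let μ : R →ₗ[R] Q := (a ^ (t + c)).mkQ ∘ₗ LinearMap.mulLeft R (f ^ (k + 1))
    let ν : R →ₗ[R] N := LinearMap.toSpanSingleton R N (f ^ k • x)
    have hle : LinearMap.ker μ ≤ LinearMap.ker ν := by
      intro r hr
      have h : f ^ (k + 1) * r ∈ a ^ (t + c) := by
        exact (Submodule.Quotient.mk_eq_zero _).1 hr
      have := key r h
      rw [mul_comm, mul_smul] at this
      simpa [ν] using this
    obtain ⟨ψ, hψ⟩ := Module.Injective.out ((LinearMap.ker μ).liftQ μ le_rfl)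
      (LinearMap.ker_eq_bot.1 (Submodule.ker_liftQ_eq_bot' _ _ rfl))
      ((LinearMap.ker μ).liftQ ν hle)
    have h1 : ψ (μ 1) = ν 1 := hψ (Submodule.Quotient.mk 1)
    -- The image of `1` under the extension is the quotient sought. It is torsion because the
    -- extension is defined on `R / a ^ (t + c)`.
    refine ⟨k, ψ (Submodule.Quotient.mk 1), mem_powTorsion_iff_ofList.2 ⟨t + c, fun r hr => ?_⟩, ?_⟩
    · rw [← map_smul, ← Submodule.Quotient.mk_smul, smul_eq_mul, mul_one,
        (Submodule.Quotient.mk_eq_zero _).2 hr, map_zero]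
    · rw [← map_smul, ← Submodule.Quotient.mk_smul, smul_eq_mul]
      exact h1.trans (one_smul R _)

end PowTorsion

/-! ### Torsion in graded modules and acyclicity of graded injectives. -/

namespace ZGradedModule

section Graded

variable {k R : Type u} [CommRing k] [CommRing R] [Algebra k R] {𝒜 : ℕ → Submodule k R}

theorem mem_of_proj_mem (X : ZGradedModule 𝒜) (U : Submodule k X) (x : X)
    (h : ∀ n, X.proj n x ∈ U) : x ∈ U := by
  classical
  have hx : DirectSum.coeLinearMap X.deg (X.decomp x) = x :=
    (LinearEquiv.ofBijective (DirectSum.coeLinearMap X.deg) X.isInternal).apply_symm_apply x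
  rw [← hx, DirectSum.coeLinearMap_eq_dfinsuppSum]
  exact Submodule.sum_mem _ fun n _ => h n

theorem proj_smul (X : ZGradedModule 𝒜) {a : ℕ} {r : R} (hr : r ∈ 𝒜 a) (n : ℤ) (x : X) :
    X.proj (a + n) (r • x) = r • X.proj n x := by
  refine X.hom_ext (X.proj (a + n) ∘ₗ Module.toModuleEnd k (S := R) X r)
    (Module.toModuleEnd k (S := R) X r ∘ₗ X.proj n) (fun m y hy => ?_) x
  change X.proj (a + n) (r • y) = r • X.proj n y
  by_cases hnm : n = m
  · subst hnm
    rw [X.proj_self n y hy, X.proj_self _ _ (X.smul_mem hr hy)]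
  · rw [X.proj_ne n m hnm y hy, X.proj_ne _ _ (by simpa using hnm) _ (X.smul_mem hr hy), smul_zero]

/-- A homogeneous `f ^ t` only shifts degrees, so if it kills `x` it kills each component of `x`. -/
theorem proj_mem_powTorsion [GradedAlgebra 𝒜] (X : ZGradedModule 𝒜) {l : List R}
    (hl : ∀ f ∈ l, ∃ a, f ∈ 𝒜 a) {x : X} (hx : x ∈ powTorsion l X) (n : ℤ) :
    X.proj n x ∈ powTorsion l X := fun f hf => by
  obtain ⟨a, ha⟩ := hl f hf
  obtain ⟨t, ht⟩ := hx f hf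
  refine ⟨t, ?_⟩
  rw [← X.proj_smul (SetLike.pow_mem_graded t ha), ht, map_zero]

/-- The monomial `x T ^ n`, as an element of the graded module `N[T, T⁻¹]`. -/
noncomputable def coinducedMono [GradedAlgebra 𝒜] (N : Type u) [AddCommGroup N] [Module k N]
    [Module R N] [IsScalarTower k R N] (n : ℤ) : N →ₗ[k] coinduced 𝒜 N :=
  Laurent.mono 𝒜 N n

theorem coinducedMono_injective [GradedAlgebra 𝒜] (N : Type u) [AddCommGroup N] [Module k N]
    [Module R N] [IsScalarTower k R N] (n : ℤ) :
    Function.Injective (coinducedMono (𝒜 := 𝒜) N n) :=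
  Function.LeftInverse.injective (Laurent.coeff_mono_self 𝒜 N n)

theorem pow_smul_coinducedMono [GradedAlgebra 𝒜] (N : Type u) [AddCommGroup N] [Module k N]
    [Module R N] [IsScalarTower k R N] {g : R} {b : ℕ} (hg : g ∈ 𝒜 b) (t : ℕ) (m : ℤ) (w : N) :
    g ^ t • coinducedMono (𝒜 := 𝒜) N m w = coinducedMono N ((t * b : ℕ) + m) (g ^ t • w) :=
  Laurent.smul_mono 𝒜 N (SetLike.pow_mem_graded t hg) m w

/-- Homogeneous components reduce the claim to monomials `v T ^ n`, where torsion and divisibility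
are those of the coefficient `v` in `N`. -/
theorem coinduced_isTorsionAcyclic [GradedAlgebra 𝒜] (N : Type u) [AddCommGroup N] [Module k N]
    [Module R N] [IsScalarTower k R N] {l : List R} (hl : ∀ f ∈ l, ∃ a, f ∈ 𝒜 a)
    (hN : IsTorsionAcyclic l N) : IsTorsionAcyclic l (coinduced 𝒜 N) := by
  induction l with
  | nil => trivial
  | cons f l ih =>
    have hl' : ∀ g ∈ l, ∃ a, g ∈ 𝒜 a := fun g hg => hl g (List.mem_cons_of_mem _ hg)
    refine ⟨ih hl' hN.1, fun x hx => ?_⟩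
    obtain ⟨a, ha⟩ := hl f List.mem_cons_self
    refine (coinduced 𝒜 N).mem_of_proj_mem (Submodule.restrictScalars k (powDivisible f _)) x
      fun n => ?_
    have hp := (coinduced 𝒜 N).proj_mem_powTorsion hl' hx n
    obtain ⟨v, hv⟩ : ∃ v, coinducedMono N n v = (coinduced 𝒜 N).proj n x :=
      (coinduced 𝒜 N).proj_mem n x
    rw [← hv] at hp ⊢
    have hv' : v ∈ powTorsion l N := fun g hg => by
      obtain ⟨b, hb⟩ := hl' g hg
      obtain ⟨t, ht⟩ := hp g hg
      refine ⟨t, ?_⟩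
      rwa [pow_smul_coinducedMono N hb, map_eq_zero_iff _ (coinducedMono_injective N _)] at ht
    obtain ⟨j, w, hw, hj⟩ := hN.2 hv'
    -- The exponent drops by `a`, since `f` has degree `a` and raises it by that much.
    refine ⟨j, coinducedMono N (n - a) w, fun g hg => ?_, ?_⟩
    · obtain ⟨b, hb⟩ := hl' g hg
      obtain ⟨t, ht⟩ := hw g hg
      exact ⟨t, by rw [pow_smul_coinducedMono N hb, ht, map_zero]⟩
    · rw [pow_smul_coinducedMono N ha, pow_smul_coinducedMono N ha, hj]
      congr 2
      push_cast
      ring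

/-- Graded injective modules over a Noetherian ring are acyclic for torsion with respect to
homogeneous elements. -/
theorem IsGradedInjective.isTorsionAcyclic [GradedAlgebra 𝒜] [IsNoetherianRing R]
    {E : ZGradedModule 𝒜} (hE : E.IsGradedInjective) {l : List R}
    (hl : ∀ f ∈ l, ∃ a, f ∈ 𝒜 a) : IsTorsionAcyclic l E := by
  obtain ⟨⟨I, hI, f, hf⟩⟩ :=
    (inferInstance : CategoryTheory.EnoughInjectives (ModuleCat.{u} R)).presentation
      (ModuleCat.of R E)
  have hinj : Module.Injective R I := Module.injective_module_of_injective_object R I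
  let _ : Module k I := Module.compHom I (algebraMap k R)
  have : IsScalarTower k R I := .of_algebraMap_smul fun _ _ => rfl
  -- Extending the identity of `E` along its graded embedding into `I[T, T⁻¹]` gives a retraction.
  obtain ⟨p, -, hp⟩ := hE E (coinduced 𝒜 I) (lift f.hom) LinearMap.id (lift_graded _)
    (lift_injective _ ((ModuleCat.mono_iff_injective f).1 hf)) (fun _ _ h => h)
  exact (coinduced_isTorsionAcyclic I hl (.of_injective l I)).of_retract (lift f.hom) p
    (fun x => LinearMap.congr_fun hp x)

theorem mem_torsionDeg {X : ZGradedModule 𝒜} {J : Ideal R} {n : ℤ} {x : X} {l : List R}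
    (hJ : J = Ideal.ofList l) :
    x ∈ torsionDeg J X n ↔ x ∈ X.deg n ∧ x ∈ powTorsion l X := by
  subst hJ
  rw [mem_powTorsion_iff_ofList]
  rfl

/-- Extension of graded maps into a graded injective module. -/
theorem IsGradedInjective.exists_extension {I : ZGradedModule 𝒜} (hI : I.IsGradedInjective)
    {Y Z : ZGradedModule 𝒜} (b : Y →ₗ[R] Z) (hb : IsGradedMap b) (ψ : Y →ₗ[R] I)
    (hψ : IsGradedMap ψ) (h : ∀ y, b y = 0 → ψ y = 0) :
    ∃ χ : Z →ₗ[R] I, IsGradedMap χ ∧ ∀ y, χ (b y) = ψ y := by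
  -- The quotient of `Y` by the graded submodule `ker b` embeds in `Z`, and `ψ` factors through it;
  -- injectivity applies to this embedding.
  let Q : ZGradedModule 𝒜 := Y.ofSurjective (Y ⧸ LinearMap.ker b) (LinearMap.ker b).mkQ
    (Submodule.mkQ_surjective _) (by
      intro y hy n
      rw [Submodule.mkQ_apply, Submodule.Quotient.mk_eq_zero, LinearMap.mem_ker] at hy ⊢
      rw [← proj_map b hb, hy, map_zero])
  obtain ⟨χ, hχ, he⟩ := hI Q Z ((LinearMap.ker b).liftQ b le_rfl)
    ((LinearMap.ker b).liftQ ψ (fun y hy => h y hy))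
    (by rintro n _ ⟨y, hy, rfl⟩; exact hb n y hy)
    (LinearMap.ker_eq_bot.1 (Submodule.ker_liftQ_eq_bot' _ _ rfl))
    (by rintro n _ ⟨y, hy, rfl⟩; exact hψ n y hy)
  exact ⟨χ, hχ, fun y => LinearMap.congr_fun he (Submodule.Quotient.mk y)⟩

end Graded

end ZGradedModule

/-! ### Comparison of acyclic resolutions with injective ones. -/

/-- A map that is bijective on subquotients induces an isomorphism of them. -/
theorem nonempty_subquotient_equiv {k V W : Type*} [CommRing k] [AddCommGroup V] [Module k V]
    [AddCommGroup W] [Module k W] (g : V →ₗ[k] W) {Z B : Submodule k V} {Z' B' : Submodule k W}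
    (hZ : ∀ z ∈ Z, g z ∈ Z') (hB : ∀ b ∈ B, g b ∈ B')
    (hsurj : ∀ z' ∈ Z', ∃ z ∈ Z, g z - z' ∈ B') (hinj : ∀ z ∈ Z, g z ∈ B' → z ∈ B) :
    Nonempty ((Z ⧸ B.submoduleOf Z) ≃ₗ[k] (Z' ⧸ B'.submoduleOf Z')) := by
  let h : Z →ₗ[k] Z' := g.restrict hZ
  have hle : B.submoduleOf Z ≤ (B'.submoduleOf Z').comap h := fun z hz => hB z hz
  refine ⟨LinearEquiv.ofBijective (Submodule.mapQ _ _ h hle) ⟨?_, ?_⟩⟩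
  · rw [← LinearMap.ker_eq_bot, LinearMap.ker_eq_bot']
    intro x hx
    obtain ⟨z, rfl⟩ := Submodule.Quotient.mk_surjective _ x
    rw [Submodule.mapQ_apply, Submodule.Quotient.mk_eq_zero] at hx
    exact (Submodule.Quotient.mk_eq_zero _).2 (hinj z z.2 hx)
  · intro y
    obtain ⟨z', rfl⟩ := Submodule.Quotient.mk_surjective _ y
    obtain ⟨z, hz, hzz⟩ := hsurj z' z'.2
    refine ⟨Submodule.Quotient.mk ⟨z, hz⟩, ?_⟩
    rw [Submodule.mapQ_apply, Submodule.Quotient.eq]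
    exact hzz

/-- Torsion is exact on exact sequences of acyclic modules. -/
theorem exists_powTorsion_preimage {R : Type*} [CommRing R] {l : List R} {K : ℕ → Type*}
    [∀ j, AddCommGroup (K j)] [∀ j, Module R (K j)] (d : ∀ j, K j →ₗ[R] K (j + 1))
    (hK : ∀ j, IsTorsionAcyclic l (K j)) (h0 : IsTorsionAcyclic l (LinearMap.ker (d 0)))
    (hd : ∀ j, Function.Exact (d j) (d (j + 1))) (j : ℕ) (x : K (j + 1))
    (hx : x ∈ powTorsion l (K (j + 1))) (hdx : d (j + 1) x = 0) :
    ∃ y ∈ powTorsion l (K j), d j y = x := by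
  let p : ∀ j, K j →ₗ[R] LinearMap.ker (d (j + 1)) := fun j =>
    (d j).codRestrict _ fun y => (hd j).apply_apply_eq_zero y
  have hp : ∀ j, Function.Surjective (p j) := fun j ⟨x, hx⟩ => by
    obtain ⟨y, rfl⟩ := (hd j x).1 hx
    exact ⟨y, rfl⟩
  have hex : ∀ j, Function.Exact (LinearMap.ker (d j)).subtype (p j) := fun j y =>
    ⟨fun h => ⟨⟨y, congrArg Subtype.val h⟩, rfl⟩, by rintro ⟨z, rfl⟩; exact Subtype.ext z.2⟩
  -- The sequences `0 → ker d_j → K_j → ker d_{j+1} → 0` carry acyclicity from one kernel to the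
  -- next.
  have hker : ∀ j, IsTorsionAcyclic l (LinearMap.ker (d j)) := fun j => by
    induction j with
    | zero => exact h0
    | succ j ih =>
      exact ih.of_exact (hK j) _ (p j) (Submodule.injective_subtype _) (hp j) (hex j)
  obtain ⟨y, hy, hyx⟩ := (hker j).exists_lift _ (p j) (Submodule.injective_subtype _) (hp j) (hex j)
    ⟨x, hdx⟩ (mem_powTorsion_of_injective (Submodule.subtype _) (Submodule.injective_subtype _) hx)
  exact ⟨y, hy, congrArg Subtype.val hyx⟩

namespace ZGradedModule

variable {k R : Type u} [CommRing k] [CommRing R] [Algebra k R] {𝒜 : ℕ → Submodule k R}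

/-- A resolution `0 → M → C⁰ → C¹ → ⋯` in the category of graded `R`-modules. -/
structure Resolution (M : ZGradedModule 𝒜) where
  obj : ℕ → ZGradedModule 𝒜
  ι : M →ₗ[R] obj 0
  ι_graded : IsGradedMap ι
  ι_injective : Function.Injective ι
  d : ∀ i, obj i →ₗ[R] obj (i + 1)
  d_graded : ∀ i, IsGradedMap (d i)
  exact_zero : Function.Exact ι (d 0)
  exact_succ : ∀ i, Function.Exact (d i) (d (i + 1))

namespace Resolution

variable {M : ZGradedModule 𝒜} (C : Resolution M) (J : Ideal R)

/-- The cocycles of the complex `Γ_J(C)ₙ` of `k`-modules. -/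
def cocycles (i : ℕ) (n : ℤ) : Submodule k (C.obj i) :=
  torsionDeg J (C.obj i) n ⊓ LinearMap.ker ((C.d i).restrictScalars k)

/-- The coboundaries of the complex `Γ_J(C)ₙ` of `k`-modules. -/
def coboundaries : (i : ℕ) → (n : ℤ) → Submodule k (C.obj i)
  | 0, _ => ⊥
  | i + 1, n => (torsionDeg J (C.obj i) n).map ((C.d i).restrictScalars k)

/-- The `i`-th cohomology of the complex `Γ_J(C)ₙ` of `k`-modules. -/
abbrev cohomology (i : ℕ) (n : ℤ) : Type u :=
  C.cocycles J i n ⧸ (C.coboundaries J i n).submoduleOf (C.cocycles J i n)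

/-- A graded chain map from a resolution to an injective resolution over the identity. -/
theorem exists_hom_injectiveResolution (I : InjectiveResolution M) :
    ∃ φ : ∀ i, C.obj i →ₗ[R] I.obj i, (∀ i, IsGradedMap (φ i)) ∧
      (∀ m, φ 0 (C.ι m) = I.ι m) ∧ ∀ i c, φ (i + 1) (C.d i c) = I.d i (φ i c) := by
  obtain ⟨φ₀, hφ₀, h₀⟩ := (I.injective 0).exists_extension C.ι C.ι_graded I.ι I.ι_graded
    (fun m hm => by rw [C.ι_injective (hm.trans (map_zero _).symm), map_zero])
  -- The recursion carries the condition that `I.d i ∘ φ` vanishes on `ker (C.d i)`, which is what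
  -- the extension of the next map along `C.d i` requires.
  let P : ℕ → Type u := fun i => {φ : C.obj i →ₗ[R] I.obj i //
    IsGradedMap φ ∧ ∀ c, C.d i c = 0 → I.d i (φ c) = 0}
  have step : ∀ i (φ : P i), ∃ φ' : P (i + 1), ∀ c, φ'.1 (C.d i c) = I.d i (φ.1 c) := by
    rintro i ⟨φ, hφ, hk⟩
    obtain ⟨χ, hχ, he⟩ := (I.injective (i + 1)).exists_extension (C.d i) (C.d_graded i)
      (I.d i ∘ₗ φ) (fun n x hx => I.d_graded i n _ (hφ n x hx)) hk
    refine ⟨⟨χ, hχ, fun c hc => ?_⟩, he⟩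
    obtain ⟨c, rfl⟩ := (C.exact_succ i c).1 hc
    rw [he]
    exact (I.exact_succ i).apply_apply_eq_zero _
  choose s hs using step
  let φ : ∀ i, P i := fun i => Nat.rec ⟨φ₀, hφ₀, fun c hc => by
    obtain ⟨m, rfl⟩ := (C.exact_zero c).1 hc
    rw [h₀]
    exact I.exact_zero.apply_apply_eq_zero m⟩ s i
  exact ⟨fun i => (φ i).1, fun i => (φ i).2.1, h₀, fun i c => hs i (φ i) c⟩

section Cone

variable {C} {I : InjectiveResolution M} {φ : ∀ i, C.obj i →ₗ[R] I.obj i}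

/-- Torsion in the mapping cone of a chain map between acyclic resolutions is exact. -/
theorem exists_powTorsion_preimage_cone {l : List R}
    (hC : ∀ i, IsTorsionAcyclic l (C.obj i)) (hI : ∀ i, IsTorsionAcyclic l (I.obj i))
    (hφ₀ : ∀ m, φ 0 (C.ι m) = I.ι m) (hφ : ∀ i c, φ (i + 1) (C.d i c) = I.d i (φ i c)) :
    (∀ (x : C.obj 1) (e : I.obj 0), x ∈ powTorsion l (C.obj 1) → e ∈ powTorsion l (I.obj 0) →
      C.d 1 x = 0 → φ 1 x = I.d 0 e → ∃ y ∈ powTorsion l (C.obj 0), C.d 0 y = x ∧ φ 0 y = e) ∧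
    ∀ i (x : C.obj (i + 2)) (e : I.obj (i + 1)), x ∈ powTorsion l (C.obj (i + 2)) →
      e ∈ powTorsion l (I.obj (i + 1)) → C.d (i + 2) x = 0 → φ (i + 2) x = I.d (i + 1) e →
      ∃ y ∈ powTorsion l (C.obj (i + 1)), ∃ e' ∈ powTorsion l (I.obj i),
        C.d (i + 1) y = x ∧ φ (i + 1) y - I.d i e' = e := by
  -- The cone is `C⁰ → C¹ × I⁰ → C² × I¹ → ⋯`; its initial term `C⁰` is treated separately through
  -- `γ`.
  let K : ℕ → Type u := fun i => C.obj (i + 1) × I.obj i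
  let δ : ∀ i, K i →ₗ[R] K (i + 1) := fun i =>
    (C.d (i + 1) ∘ₗ LinearMap.fst R _ _).prod
      (φ (i + 1) ∘ₗ LinearMap.fst R _ _ - I.d i ∘ₗ LinearMap.snd R _ _)
  have hδ : ∀ i (x : C.obj (i + 1)) (e : I.obj i),
      δ i (x, e) = (C.d (i + 1) x, φ (i + 1) x - I.d i e) := fun _ _ _ => rfl
  let γ : C.obj 0 →ₗ[R] K 0 := (C.d 0).prod (φ 0)
  have hγ : Function.Injective γ := by
    rw [← LinearMap.ker_eq_bot, LinearMap.ker_eq_bot']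
    intro c hc
    obtain ⟨h₁, h₂⟩ := Prod.ext_iff.1 hc
    obtain ⟨m, rfl⟩ := (C.exact_zero c).1 h₁
    have h₃ : I.ι m = 0 := (hφ₀ m).symm.trans h₂
    rw [I.ι_injective (h₃.trans (map_zero _).symm), map_zero]
  have hγδ : ∀ x, δ 0 x = 0 ↔ x ∈ LinearMap.range γ := by
    rintro ⟨x, e⟩
    constructor
    · intro h
      obtain ⟨h₁, h₂⟩ := Prod.ext_iff.1 h
      obtain ⟨c, rfl⟩ := (C.exact_succ 0 x).1 h₁
      have h₂' : φ 1 (C.d 0 c) - I.d 0 e = 0 := h₂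
      obtain ⟨m, hm⟩ := (I.exact_zero (φ 0 c - e)).1 (by rw [map_sub, ← hφ, h₂'])
      refine ⟨c - C.ι m, Prod.ext ?_ ?_⟩
      · change C.d 0 (c - C.ι m) = C.d 0 c
        rw [map_sub, C.exact_zero.apply_apply_eq_zero, sub_zero]
      · change φ 0 (c - C.ι m) = e
        rw [map_sub, hφ₀, hm, sub_sub_cancel]
    · rintro ⟨c, hc⟩
      rw [← hc, show γ c = (C.d 0 c, φ 0 c) from rfl, hδ, hφ, sub_self,
        (C.exact_succ 0).apply_apply_eq_zero]
      rfl
  have hex : ∀ i, Function.Exact (δ i) (δ (i + 1)) := by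
    rintro i ⟨x, e⟩
    constructor
    · intro h
      obtain ⟨h₁, h₂⟩ := Prod.ext_iff.1 h
      obtain ⟨c, rfl⟩ := (C.exact_succ (i + 1) x).1 h₁
      have h₂' : φ (i + 1 + 1) (C.d (i + 1) c) - I.d (i + 1) e = 0 := h₂
      obtain ⟨e', he'⟩ := (I.exact_succ i (φ (i + 1) c - e)).1 (by rw [map_sub, ← hφ, h₂'])
      exact ⟨(c, e'), by rw [hδ, he', sub_sub_cancel]⟩
    · rintro ⟨⟨c, e'⟩, hc⟩
      rw [← hc, hδ, hδ, map_sub, hφ, (C.exact_succ (i + 1)).apply_apply_eq_zero,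
        (I.exact_succ i).apply_apply_eq_zero, sub_zero, sub_self]
      rfl
  -- The first kernel is a copy of `C⁰`, which starts the induction on kernels.
  have hker : IsTorsionAcyclic l (LinearMap.ker (δ 0)) := by
    refine (hC 0).of_equiv ((LinearEquiv.ofInjective γ hγ).trans (LinearEquiv.ofEq _ _ ?_))
    ext x
    exact (hγδ x).symm
  refine ⟨fun x e hx he hdx hxe => ?_, fun i x e hx he hdx hxe => ?_⟩
  · obtain ⟨y, hy⟩ := (hγδ (x, e)).1 (by rw [hδ, hdx, hxe, sub_self]; rfl)
    obtain ⟨h₁, h₂⟩ := Prod.ext_iff.1 hy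
    refine ⟨y, mem_powTorsion_of_injective γ hγ ?_, h₁, h₂⟩
    rw [hy]
    exact mem_powTorsion_prod.2 ⟨hx, he⟩
  · obtain ⟨⟨y, e'⟩, hy, hyx⟩ := exists_powTorsion_preimage δ (fun i => (hC _).prod (hI i)) hker hex
      i (x, e) (mem_powTorsion_prod.2 ⟨hx, he⟩) (by rw [hδ, hdx, hxe, sub_self]; rfl)
    obtain ⟨h₁, h₂⟩ := Prod.ext_iff.1 hyx
    obtain ⟨h₃, h₄⟩ := mem_powTorsion_prod.1 hy
    exact ⟨y, h₃, e', h₄, h₁, h₂⟩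

end Cone

/-- Local cohomology is computed by acyclic resolutions. -/
theorem nonempty_cohomology_equiv [GradedAlgebra 𝒜] [IsNoetherianRing R] {l : List R}
    (hl : ∀ f ∈ l, ∃ a, f ∈ 𝒜 a) (hJ : J = Ideal.ofList l)
    (hC : ∀ i, IsTorsionAcyclic l (C.obj i)) (I : InjectiveResolution M) (i : ℕ) (n : ℤ) :
    Nonempty (C.cohomology J i n ≃ₗ[k] I.cohomology J i n) := by
  obtain ⟨φ, hφg, hφ₀, hφ⟩ := C.exists_hom_injectiveResolution I
  have htors : ∀ i, ∀ x ∈ torsionDeg J (C.obj i) n, φ i x ∈ torsionDeg J (I.obj i) n := by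
    intro i x hx
    rw [mem_torsionDeg hJ] at hx ⊢
    exact ⟨hφg i n x hx.1, map_mem_powTorsion _ hx.2⟩
  have hproj : ∀ {X : ZGradedModule 𝒜} {x : X}, x ∈ powTorsion l X →
      X.proj n x ∈ torsionDeg J X n := fun {X x} hx =>
    (mem_torsionDeg hJ).2 ⟨X.proj_mem n x, X.proj_mem_powTorsion hl hx n⟩
  obtain ⟨hcone₀, hcone⟩ := exists_powTorsion_preimage_cone hC
    (fun i => (I.injective i).isTorsionAcyclic hl) hφ₀ hφ
  -- Exactness of the torsion of the cone, restricted to degree `n`. The preimages found need not be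
  -- homogeneous, so they are replaced by their components of degree `n`. For `i = 0` the
  -- coboundaries vanish and `φ 0 y = e` holds exactly.
  have key : ∀ i, ∀ x ∈ torsionDeg J (C.obj (i + 1)) n, ∀ e ∈ torsionDeg J (I.obj i) n,
      C.d (i + 1) x = 0 → φ (i + 1) x = I.d i e →
      ∃ y ∈ torsionDeg J (C.obj i) n, C.d i y = x ∧ φ i y - e ∈ I.coboundaries J i n := by
    intro i x hx e he hdx hxe
    rw [mem_torsionDeg hJ] at hx he
    cases i with
    | zero =>
      obtain ⟨y, hy, h₁, h₂⟩ := hcone₀ x e hx.2 he.2 hdx hxe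
      refine ⟨_, hproj hy, ?_, ?_⟩
      · rw [← proj_map _ (C.d_graded 0), h₁, proj_self _ _ _ hx.1]
      · rw [← proj_map _ (hφg 0), h₂, proj_self _ _ _ he.1, sub_self]
        exact zero_mem _
    | succ i =>
      obtain ⟨y, hy, e', he', h₁, h₂⟩ := hcone i x e hx.2 he.2 hdx hxe
      refine ⟨_, hproj hy, ?_, _, hproj he', ?_⟩
      · rw [← proj_map _ (C.d_graded _), h₁, proj_self _ _ _ hx.1]
      · rw [LinearMap.restrictScalars_apply, ← proj_map _ (hφg _), ← proj_map _ (I.d_graded _),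
          ← proj_self _ _ _ he.1, ← h₂, map_sub]
        simp
  refine nonempty_subquotient_equiv ((φ i).restrictScalars k) ?_ ?_ ?_ ?_
  · rintro z ⟨hz, hdz⟩
    refine ⟨htors i z hz, ?_⟩
    change I.d i (φ i z) = 0
    rw [← hφ, show C.d i z = 0 from hdz, map_zero]
  · cases i with
    | zero =>
      rintro b rfl
      exact map_zero _
    | succ i =>
      rintro _ ⟨c, hc, rfl⟩
      exact ⟨φ i c, htors i c hc, (hφ i c).symm⟩
  · rintro e ⟨he, hde⟩
    -- Surjectivity on cohomology is the case of the cone element `(0, e)`; injectivity below uses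
    -- `(z, e)` with `φ z = d e`.
    obtain ⟨y, hy, hdy, h⟩ := key i 0 (zero_mem _) e he (map_zero _)
      (by rw [map_zero]; exact (show I.d i e = 0 from hde).symm)
    exact ⟨y, ⟨hy, hdy⟩, h⟩
  · rintro z ⟨hz, hdz⟩ hb
    cases i with
    | zero =>
      have hb' : φ 0 z = 0 := hb
      obtain ⟨m, rfl⟩ := (C.exact_zero z).1 hdz
      rw [hφ₀] at hb'
      rw [I.ι_injective (hb'.trans (map_zero _).symm), map_zero]
      exact zero_mem _
    | succ i =>
      obtain ⟨e, he, hez⟩ := hb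
      obtain ⟨y, hy, hdy, -⟩ := key i z hz e he hdz hez.symm
      exact ⟨y, hy, hdy⟩

end Resolution

end ZGradedModule

/-! ### Flat base change of submodules and subquotients. -/

section FlatSubmodule

variable {A : Type*} (S : Type*) [CommRing A] [CommRing S] [Algebra A S]
  {V W H : Type*} [AddCommGroup V] [Module A V] [AddCommGroup W] [Module A W]
  [AddCommGroup H] [Module A H]

theorem Submodule.mem_baseChange_ker_iff_of_surjective (g : V →ₗ[A] W)
    (hg : Function.Surjective g) (x : S ⊗[A] V) :
    x ∈ (LinearMap.ker g).baseChange S ↔ g.baseChange S x = 0 :=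
  (lTensor_exact S (LinearMap.exact_subtype_ker_map g) hg x).symm

theorem Submodule.mem_baseChange_iff (p : Submodule A V) (x : S ⊗[A] V) :
    x ∈ p.baseChange S ↔ p.mkQ.baseChange S x = 0 := by
  rw [← mem_baseChange_ker_iff_of_surjective S p.mkQ p.mkQ_surjective, p.ker_mkQ]

theorem Submodule.baseChange_map (f : V →ₗ[A] W) (p : Submodule A V) :
    (p.map f).baseChange S = (p.baseChange S).map (f.baseChange S) := by
  rw [baseChange_eq_span, baseChange_eq_span, LinearMap.map_span]
  congr 1
  ext y
  constructor
  · rintro ⟨_, ⟨x, hx, rfl⟩, rfl⟩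
    exact ⟨1 ⊗ₜ x, ⟨x, hx, rfl⟩, by simp⟩
  · rintro ⟨_, ⟨x, hx, rfl⟩, rfl⟩
    exact ⟨f x, ⟨x, hx, rfl⟩, by simp⟩

variable [Module.Flat A S]

theorem Submodule.mem_baseChange_ker_iff (g : V →ₗ[A] W) (x : S ⊗[A] V) :
    x ∈ (LinearMap.ker g).baseChange S ↔ g.baseChange S x = 0 :=
  (Module.Flat.lTensor_exact S (LinearMap.exact_subtype_ker_map g) x).symm

/-- The intersection is the kernel of `V → V/p × V/q`, and flatness preserves kernels. -/
theorem Submodule.baseChange_inf (p q : Submodule A V) :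
    (p ⊓ q).baseChange S = p.baseChange S ⊓ q.baseChange S := by
  have h : p ⊓ q = LinearMap.ker (p.mkQ.prod q.mkQ) := by
    rw [LinearMap.ker_prod, ker_mkQ, ker_mkQ]
  ext x
  rw [h, mem_baseChange_ker_iff, mem_inf, mem_baseChange_iff, mem_baseChange_iff]
  have hf : (LinearMap.fst A (V ⧸ p) (V ⧸ q)).baseChange S ∘ₗ (p.mkQ.prod q.mkQ).baseChange S =
      p.mkQ.baseChange S := by rw [← LinearMap.baseChange_comp, LinearMap.fst_prod]
  have hs : (LinearMap.snd A (V ⧸ p) (V ⧸ q)).baseChange S ∘ₗ (p.mkQ.prod q.mkQ).baseChange S =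
      q.mkQ.baseChange S := by rw [← LinearMap.baseChange_comp, LinearMap.snd_prod]
  rw [← hf, ← hs]
  set y := (p.mkQ.prod q.mkQ).baseChange S x with hy
  simp only [LinearMap.comp_apply, ← hy]
  constructor
  · intro h
    simp [h]
  · rintro ⟨h₁, h₂⟩
    have hid : (LinearMap.inl A (V ⧸ p) (V ⧸ q)).baseChange S ∘ₗ
          (LinearMap.fst A (V ⧸ p) (V ⧸ q)).baseChange S +
        (LinearMap.inr A (V ⧸ p) (V ⧸ q)).baseChange S ∘ₗ
          (LinearMap.snd A (V ⧸ p) (V ⧸ q)).baseChange S = LinearMap.id := by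
      rw [← LinearMap.baseChange_comp, ← LinearMap.baseChange_comp, ← LinearMap.baseChange_add,
        show LinearMap.inl A (V ⧸ p) (V ⧸ q) ∘ₗ LinearMap.fst A _ _ +
          LinearMap.inr A _ _ ∘ₗ LinearMap.snd A _ _ = LinearMap.id from by ext <;> simp,
        LinearMap.baseChange_id]
    rw [← LinearMap.id_apply (R := S) y, ← hid]
    simp [h₁, h₂]

variable {S} in
/-- Flat base change commutes with subquotients. -/
theorem nonempty_subquotient_baseChange_equiv {V' : Type*} [AddCommGroup V'] [Module S V']
    (τ : S ⊗[A] V ≃ₗ[S] V') {Z B : Submodule A V} (hBZ : B ≤ Z) {Z' B' : Submodule S V'}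
    (hZ : ∀ x, τ x ∈ Z' ↔ x ∈ Z.baseChange S) (hB : ∀ x, τ x ∈ B' ↔ x ∈ B.baseChange S)
    (π : Z →ₗ[A] H) (hπ : Function.Surjective π) (hker : ∀ z : Z, π z = 0 ↔ (z : V) ∈ B) :
    Nonempty ((Z' ⧸ B'.submoduleOf Z') ≃ₗ[S] S ⊗[A] H) := by
  have hinj : Function.Injective (Z.subtype.baseChange S) :=
    Module.Flat.lTensor_preserves_injective_linearMap Z.subtype Z.injective_subtype
  -- By flatness `S ⊗ Z` embeds in `S ⊗ V`, so it is identified with `Z'`.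
  let e : S ⊗[A] Z ≃ₗ[S] Z' := LinearEquiv.ofBijective
    ((τ.toLinearMap ∘ₗ Z.subtype.baseChange S).codRestrict Z' fun w => (hZ _).2 ⟨w, rfl⟩) ⟨by
      intro x y hxy
      exact hinj (τ.injective (congrArg Subtype.val hxy)), by
      rintro ⟨z, hz⟩
      obtain ⟨x, rfl⟩ := τ.surjective z
      obtain ⟨w, rfl⟩ := (hZ x).1 hz
      exact ⟨w, rfl⟩⟩
  let ψ : Z' →ₗ[S] S ⊗[A] H := π.baseChange S ∘ₗ e.symm.toLinearMap
  have hψ : Function.Surjective ψ :=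
    (LinearMap.lTensor_surjective S hπ).comp e.symm.surjective
  refine ⟨(Submodule.quotEquivOfEq _ _ ?_).trans (ψ.quotKerEquivOfSurjective hψ)⟩
  ext w
  obtain ⟨w, rfl⟩ := e.surjective w
  change τ (Z.subtype.baseChange S w) ∈ B' ↔ π.baseChange S (e.symm (e w)) = 0
  rw [e.symm_apply_apply, hB]
  constructor
  · rintro ⟨b, hb⟩
    have hw : w = (Submodule.inclusion hBZ).baseChange S b := by
      apply hinj
      rw [← hb, ← LinearMap.comp_apply, ← LinearMap.baseChange_comp,
        Submodule.subtype_comp_inclusion]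
    have h0 : π ∘ₗ Submodule.inclusion hBZ = 0 := LinearMap.ext fun b => (hker _).2 b.2
    rw [hw, ← LinearMap.comp_apply, ← LinearMap.baseChange_comp, h0, LinearMap.baseChange_zero,
      LinearMap.zero_apply]
  · intro hw
    rw [← Submodule.mem_baseChange_ker_iff_of_surjective S π hπ] at hw
    have : (LinearMap.ker π).baseChange S ≤ (B.baseChange S).comap (Z.subtype.baseChange S) := by
      rw [Submodule.baseChange_eq_span, Submodule.span_le]
      rintro _ ⟨z, hz, rfl⟩
      exact Submodule.tmul_mem_baseChange_of_mem 1 ((hker z).1 hz)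
    exact this hw

variable {S} in
/-- Flat base change commutes with subquotients of modules over an `A`-algebra `k`. -/
theorem nonempty_subquotient_baseChange_equiv_of_tower {k : Type*} [CommRing k] [Algebra A k]
    [Module k V] [IsScalarTower A k V] {V' : Type*} [AddCommGroup V'] [Module S V']
    (τ : S ⊗[A] V ≃ₗ[S] V') {Z B : Submodule k V} (hBZ : B ≤ Z) {Z' B' : Submodule S V'}
    (hZ : ∀ x, τ x ∈ Z' ↔ x ∈ (Z.restrictScalars A).baseChange S)
    (hB : ∀ x, τ x ∈ B' ↔ x ∈ (B.restrictScalars A).baseChange S) :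
    Nonempty ((Z' ⧸ B'.submoduleOf Z') ≃ₗ[S] S ⊗[A] (Z ⧸ B.submoduleOf Z)) := by
  let π : Z.restrictScalars A →ₗ[A] Z ⧸ B.submoduleOf Z :=
    { toFun := fun z => Submodule.Quotient.mk ⟨z.1, z.2⟩
      map_add' := fun _ _ => rfl
      map_smul' := fun _ _ => rfl }
  refine nonempty_subquotient_baseChange_equiv τ (Submodule.restrictScalars_mono A hBZ) hZ hB π ?_
    (fun z => Submodule.Quotient.mk_eq_zero _)
  intro y
  obtain ⟨z, rfl⟩ := Submodule.Quotient.mk_surjective _ y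
  exact ⟨⟨z.1, z.2⟩, rfl⟩

end FlatSubmodule

/-! ### Flat base change of graded local cohomology. -/

namespace ZGradedModule

variable {k R : Type u} [CommRing k] [CommRing R] [Algebra k R]
variable (A : Type u) [CommRing A] [Algebra A k] [Algebra A R] [IsScalarTower A k R]
variable (S : Type u) [CommRing S] [Algebra A S]
variable {𝒜 : ℕ → Submodule k R}

/-- The underlying module of `X.baseChange A S` is `S ⊗[A] X`. -/
noncomputable def baseChangeEquiv (X : ZGradedModule 𝒜) [Module A X] [IsScalarTower A k X] :
    S ⊗[A] X ≃ₗ[S] X.baseChange A S :=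
  LinearEquiv.refl S (S ⊗[A] X)

section

variable (X : ZGradedModule 𝒜) [Module A X] [IsScalarTower A k X]

theorem tmul_smul_baseChangeEquiv (s t : S) (r : R) (x : X) :
    (s ⊗ₜ[A] r : S ⊗[A] R) • X.baseChangeEquiv A S (t ⊗ₜ x) =
      X.baseChangeEquiv A S ((s * t) ⊗ₜ (r • x)) := rfl

theorem includeRight_smul_baseChangeEquiv (r : R) (z : S ⊗[A] X) :
    (Algebra.TensorProduct.includeRight (R := A) (A := S) r) • X.baseChangeEquiv A S z =
      X.baseChangeEquiv A S
        (((Module.toModuleEnd k (S := R) X r).restrictScalars A).baseChange S z) := by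
  induction z using TensorProduct.induction_on with
  | zero => simp
  | add x y hx hy => rw [map_add, smul_add, hx, hy, map_add, map_add]
  | tmul s x =>
    rw [Algebra.TensorProduct.includeRight_apply, tmul_smul_baseChangeEquiv, one_mul]
    rfl

theorem mem_baseChange_deg (n : ℤ) (z : S ⊗[A] X) :
    X.baseChangeEquiv A S z ∈ (X.baseChange A S).deg n ↔
      z ∈ ((X.deg n).restrictScalars A).baseChange S := Iff.rfl

/-- A finite list admits a uniform exponent `t`, and the elements killed by every `f ^ t` form a
finite intersection of kernels, which flat base change preserves. The converse is checked on
generators `1 ⊗ x`. -/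
theorem mem_powTorsion_baseChange [Module.Flat A S] (l : List R) (z : S ⊗[A] X) :
    X.baseChangeEquiv A S z ∈ powTorsion
        (l.map (Algebra.TensorProduct.includeRight : R →ₐ[A] S ⊗[A] R)) (X.baseChange A S) ↔
      z ∈ (((powTorsion l X).restrictScalars k).restrictScalars A).baseChange S := by
  constructor
  · intro hz
    obtain ⟨t, ht⟩ := exists_pow_of_mem_powTorsion hz
    have key : ∃ U : Submodule A X, (∀ x ∈ U, ∀ f ∈ l, f ^ t • x = 0) ∧ z ∈ U.baseChange S := by
      clear hz
      induction l with
      | nil => exact ⟨⊤, by simp, by simp⟩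
      | cons f l ih =>
        obtain ⟨U, hU, hz⟩ := ih fun g hg => ht g (List.mem_cons_of_mem _ hg)
        refine ⟨LinearMap.ker ((Module.toModuleEnd k (S := R) X (f ^ t)).restrictScalars A) ⊓ U,
          fun x hx g hg => ?_, ?_⟩
        · rcases List.mem_cons.1 hg with rfl | hg
          · exact hx.1
          · exact hU x hx.2 g hg
        · rw [Submodule.baseChange_inf]
          refine ⟨(Submodule.mem_baseChange_ker_iff _ _ _).2 ((X.baseChangeEquiv A S).injective ?_),
            hz⟩
          rw [← includeRight_smul_baseChangeEquiv, map_pow, map_zero]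
          exact ht _ List.mem_cons_self
    obtain ⟨U, hU, hz⟩ := key
    have hle : U ≤ ((powTorsion l X).restrictScalars k).restrictScalars A :=
      fun x hx f hf => ⟨t, hU x hx f hf⟩
    exact Submodule.baseChange_mono S hle hz
  · intro hz
    rw [Submodule.baseChange_eq_span] at hz
    have hle : Submodule.span S (Submodule.map (TensorProduct.mk A S X 1)
        (((powTorsion l X).restrictScalars k).restrictScalars A) : Set (S ⊗[A] X)) ≤
        (((powTorsion (l.map (Algebra.TensorProduct.includeRight : R →ₐ[A] S ⊗[A] R))
          (X.baseChange A S))).restrictScalars S).comap (X.baseChangeEquiv A S).toLinearMap := by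
      rw [Submodule.span_le]
      rintro _ ⟨x, hx, rfl⟩ g hg
      obtain ⟨f, hf, rfl⟩ := List.mem_map.1 hg
      obtain ⟨t, ht⟩ := hx f hf
      refine ⟨t, ?_⟩
      change _ • X.baseChangeEquiv A S (1 ⊗ₜ x) = 0
      rw [← map_pow, Algebra.TensorProduct.includeRight_apply, tmul_smul_baseChangeEquiv, ht,
        TensorProduct.tmul_zero, map_zero]
    exact hle hz

theorem mem_torsionDeg_baseChange [Module.Flat A S] {J : Ideal R} {l : List R}
    (hJ : J = Ideal.ofList l) (n : ℤ) (z : S ⊗[A] X) :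
    X.baseChangeEquiv A S z ∈ torsionDeg
        (J.map (Algebra.TensorProduct.includeRight : R →ₐ[A] S ⊗[A] R)) (X.baseChange A S) n ↔
      z ∈ ((torsionDeg J X n).restrictScalars A).baseChange S := by
  have h : (torsionDeg J X n).restrictScalars A = (X.deg n).restrictScalars A ⊓
      ((powTorsion l X).restrictScalars k).restrictScalars A :=
    Submodule.ext fun x => mem_torsionDeg hJ
  rw [h, Submodule.baseChange_inf, Submodule.mem_inf, ← mem_baseChange_deg,
    ← mem_powTorsion_baseChange]
  refine mem_torsionDeg ?_
  rw [hJ]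
  exact Ideal.map_ofList _ l

/-- Torsion of the base change is generated by the `1 ⊗ x` with `x` torsion, and such an `x` can
already be divided by `f` in `X`. Divisible elements form a submodule, so generators suffice. -/
theorem isTorsionAcyclic_baseChange [Module.Flat A S] {l : List R} (h : IsTorsionAcyclic l X) :
    IsTorsionAcyclic (l.map (Algebra.TensorProduct.includeRight : R →ₐ[A] S ⊗[A] R))
      (X.baseChange A S) := by
  induction l with
  | nil => trivial
  | cons f l ih =>
    refine ⟨ih h.1, fun z hz => ?_⟩
    obtain ⟨z, rfl⟩ := (X.baseChangeEquiv A S).surjective z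
    rw [mem_powTorsion_baseChange, Submodule.baseChange_eq_span] at hz
    have hle : Submodule.span S (Submodule.map (TensorProduct.mk A S X 1)
        (((powTorsion l X).restrictScalars k).restrictScalars A) : Set (S ⊗[A] X)) ≤
        ((powDivisible (Algebra.TensorProduct.includeRight f : S ⊗[A] R)
          (powTorsion (l.map (Algebra.TensorProduct.includeRight : R →ₐ[A] S ⊗[A] R))
          (X.baseChange A S))).restrictScalars S).comap (X.baseChangeEquiv A S).toLinearMap := by
      rw [Submodule.span_le]
      rintro _ ⟨x, hx, rfl⟩
      obtain ⟨j, y, hy, hj⟩ := h.2 hx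
      refine ⟨j, X.baseChangeEquiv A S (1 ⊗ₜ y), (mem_powTorsion_baseChange A S X l _).2
        (Submodule.tmul_mem_baseChange_of_mem 1 hy), ?_⟩
      change _ = _ • X.baseChangeEquiv A S (1 ⊗ₜ x)
      rw [← map_pow, ← map_pow, Algebra.TensorProduct.includeRight_apply,
        Algebra.TensorProduct.includeRight_apply, tmul_smul_baseChangeEquiv,
        tmul_smul_baseChangeEquiv, hj]
    exact hle hz

end

section Map

variable {X Y Z : ZGradedModule 𝒜} [Module A X] [IsScalarTower A k X] [Module A Y]
  [IsScalarTower A k Y] [Module A Z] [IsScalarTower A k Z]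

/-- A map of graded modules as a map over the base ring `A`. -/
def restrictBase (f : X →ₗ[R] Y) : X →ₗ[A] Y := (f.restrictScalars k).restrictScalars A

/-- The base change of a map of graded modules. -/
noncomputable def baseChangeMap (f : X →ₗ[R] Y) :
    X.baseChange A S →ₗ[S ⊗[A] R] Y.baseChange A S where
  toFun x := Y.baseChangeEquiv A S ((restrictBase A f).baseChange S ((X.baseChangeEquiv A S).symm x))
  map_add' x y := by rw [map_add, map_add, map_add]
  map_smul' r x := by
    obtain ⟨x, rfl⟩ := (X.baseChangeEquiv A S).surjective x
    rw [RingHom.id_apply, LinearEquiv.symm_apply_apply]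
    induction r using TensorProduct.induction_on with
    | zero => rw [zero_smul, zero_smul, map_zero, map_zero, map_zero]
    | add r s hr hs => rw [add_smul, add_smul, map_add, map_add, map_add, hr, hs]
    | tmul s r =>
      induction x using TensorProduct.induction_on with
      | zero => rw [map_zero, smul_zero, map_zero, map_zero, map_zero, smul_zero]
      | add x y hx hy =>
        rw [map_add, smul_add, map_add, map_add, map_add, hx, hy, map_add, map_add, smul_add]
      | tmul t x =>
        rw [tmul_smul_baseChangeEquiv, LinearEquiv.symm_apply_apply, LinearMap.baseChange_tmul,
          LinearMap.baseChange_tmul, tmul_smul_baseChangeEquiv]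
        congr 2
        exact map_smul f r x

theorem baseChangeMap_apply (f : X →ₗ[R] Y) (z : S ⊗[A] X) :
    baseChangeMap A S f (X.baseChangeEquiv A S z) =
      Y.baseChangeEquiv A S ((restrictBase A f).baseChange S z) := rfl

theorem baseChangeMap_graded {f : X →ₗ[R] Y} (hf : IsGradedMap f) :
    IsGradedMap (baseChangeMap A S f) := by
  intro n x hx
  obtain ⟨z, rfl⟩ := (X.baseChangeEquiv A S).surjective x
  rw [mem_baseChange_deg, Submodule.baseChange_eq_span] at hx
  rw [baseChangeMap_apply, mem_baseChange_deg]
  have hle : Submodule.span S (Submodule.map (TensorProduct.mk A S X 1)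
      ((X.deg n).restrictScalars A) : Set (S ⊗[A] X)) ≤
      (((Y.deg n).restrictScalars A).baseChange S).comap ((restrictBase A f).baseChange S) := by
    rw [Submodule.span_le]
    rintro _ ⟨x, hx, rfl⟩
    exact Submodule.tmul_mem_baseChange_of_mem 1 (hf n x hx)
  exact hle hx

theorem baseChangeMap_injective [Module.Flat A S] {f : X →ₗ[R] Y} (hf : Function.Injective f) :
    Function.Injective (baseChangeMap A S f) :=
  Module.Flat.lTensor_preserves_injective_linearMap (restrictBase A f) hf

theorem baseChangeMap_exact [Module.Flat A S] {f : X →ₗ[R] Y} {g : Y →ₗ[R] Z}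
    (h : Function.Exact f g) : Function.Exact (baseChangeMap A S f) (baseChangeMap A S g) :=
  Module.Flat.lTensor_exact S (f := restrictBase A f) (g := restrictBase A g) h

end Map

/-- The base change of an injective resolution along a flat homomorphism. -/
noncomputable def InjectiveResolution.baseChange [Module.Flat A S] {M : ZGradedModule 𝒜}
    [Module A M] [IsScalarTower A k M] (E : InjectiveResolution M) [∀ i, Module A (E.obj i)]
    [∀ i, IsScalarTower A k (E.obj i)] : Resolution (M.baseChange A S) where
  obj i := (E.obj i).baseChange A S
  ι := baseChangeMap A S E.ι
  ι_graded := baseChangeMap_graded A S E.ι_graded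
  ι_injective := baseChangeMap_injective A S E.ι_injective
  d i := baseChangeMap A S (E.d i)
  d_graded i := baseChangeMap_graded A S (E.d_graded i)
  exact_zero := baseChangeMap_exact A S E.exact_zero
  exact_succ i := baseChangeMap_exact A S (E.exact_succ i)

theorem InjectiveResolution.coboundaries_le_cocycles {M : ZGradedModule 𝒜}
    (E : InjectiveResolution M) (J : Ideal R) (i : ℕ) (n : ℤ) :
    E.coboundaries J i n ≤ E.cocycles J i n := by
  cases i with
  | zero => exact bot_le
  | succ i =>
    rintro _ ⟨x, ⟨hx, t, ht⟩, rfl⟩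
    refine ⟨⟨E.d_graded i n x hx, t, fun r hr => ?_⟩, (E.exact_succ i).apply_apply_eq_zero x⟩
    rw [LinearMap.restrictScalars_apply, ← map_smul, ht r hr, map_zero]

/-- Cocycles are an intersection of torsion with a kernel, and coboundaries are images of torsion;
each construction commutes with flat base change. -/
theorem InjectiveResolution.nonempty_baseChange_cohomology_equiv [Module.Flat A S]
    {M : ZGradedModule 𝒜} [Module A M] [IsScalarTower A k M] (E : InjectiveResolution M)
    [∀ i, Module A (E.obj i)] [∀ i, IsScalarTower A k (E.obj i)] {J : Ideal R} {l : List R}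
    (hJ : J = Ideal.ofList l) (i : ℕ) (n : ℤ) :
    Nonempty ((E.baseChange A S).cohomology
        (J.map (Algebra.TensorProduct.includeRight : R →ₐ[A] S ⊗[A] R)) i n ≃ₗ[S]
      S ⊗[A] E.cohomology J i n) := by
  refine nonempty_subquotient_baseChange_equiv_of_tower ((E.obj i).baseChangeEquiv A S)
    (E.coboundaries_le_cocycles J i n) (fun z => ?_) (fun z => ?_)
  · have h : (E.cocycles J i n).restrictScalars A =
        (torsionDeg J (E.obj i) n).restrictScalars A ⊓ LinearMap.ker (restrictBase A (E.d i)) := rfl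
    rw [h, Submodule.baseChange_inf, Submodule.mem_inf, ← mem_torsionDeg_baseChange A S _ hJ,
      Submodule.mem_baseChange_ker_iff]
    rfl
  · cases i with
    | zero =>
      have h : (E.coboundaries J 0 n).restrictScalars A = ⊥ := rfl
      rw [h, Submodule.baseChange_bot]
      exact ((E.obj 0).baseChangeEquiv A S).map_eq_zero_iff
    | succ i =>
      have h : (E.coboundaries J (i + 1) n).restrictScalars A =
        ((torsionDeg J (E.obj i) n).restrictScalars A).map (restrictBase A (E.d i)) := rfl
      rw [h, Submodule.baseChange_map]
      constructor
      · rintro ⟨x, hx, hxz⟩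
        obtain ⟨x, rfl⟩ := ((E.obj i).baseChangeEquiv A S).surjective x
        exact ⟨x, (mem_torsionDeg_baseChange A S _ hJ n x).1 hx,
          ((E.obj (i + 1)).baseChangeEquiv A S).injective hxz⟩
      · rintro ⟨x, hx, rfl⟩
        exact ⟨(E.obj i).baseChangeEquiv A S x, (mem_torsionDeg_baseChange A S _ hJ n x).2 hx, rfl⟩

end ZGradedModule

/-! ### Lengths and Hilbert-Samuel functions under change of rings. -/

section Multiplicity

/-- The lengths determine which polynomials qualify, so both sides choose the same one, or both take
the default `0` when there is none. -/
theorem hilbertSamuelMultiplicity_congr {A B : Type*} [CommRing A] [CommRing B] {q : Ideal A}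
    {q' : Ideal B} {T T' : Type*} [AddCommGroup T] [Module A T] [AddCommGroup T'] [Module B T']
    (h : ∀ m : ℕ, Module.length A (T ⧸ (q ^ (m + 1) • ⊤ : Submodule A T)) =
      Module.length B (T' ⧸ (q' ^ (m + 1) • ⊤ : Submodule B T'))) :
    hilbertSamuelMultiplicity q T = hilbertSamuelMultiplicity q' T' := by
  have hP : IsHilbertSamuelPolynomial q T = IsHilbertSamuelPolynomial q' T' := by
    funext P
    simp only [IsHilbertSamuelPolynomial, h]
  unfold hilbertSamuelMultiplicity
  rw [hP]

theorem LinearEquiv.length_quotient_smul_top_eq {A : Type*} [CommRing A] (I : Ideal A)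
    {T T' : Type*} [AddCommGroup T] [Module A T] [AddCommGroup T'] [Module A T']
    (e : T ≃ₗ[A] T') :
    Module.length A (T ⧸ (I • ⊤ : Submodule A T)) =
      Module.length A (T' ⧸ (I • ⊤ : Submodule A T')) := by
  refine (Submodule.Quotient.equiv _ _ e ?_).length_eq
  rw [Submodule.map_smul'', Submodule.map_top, LinearEquiv.range]

variable {A : Type*} (S : Type*) [CommRing A] [CommRing S] [Algebra A S]

theorem Submodule.baseChange_smul_top (I : Ideal A) (T : Type*) [AddCommGroup T] [Module A T] :
    (I • ⊤ : Submodule A T).baseChange S =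
      I.map (algebraMap A S) • (⊤ : Submodule S (S ⊗[A] T)) := by
  apply le_antisymm
  · rw [baseChange_eq_span, span_le]
    rintro _ ⟨x, hx, rfl⟩
    refine Submodule.smul_induction_on hx (fun a ha t _ => ?_) (fun x y hx hy => ?_)
    · rw [map_smul, ← algebraMap_smul S a]
      exact Submodule.smul_mem_smul (Ideal.mem_map_of_mem _ ha) trivial
    · rw [map_add]
      exact add_mem hx hy
  · rw [Ideal.map, Submodule.smul_le]
    intro c hc z _
    refine Submodule.span_induction (fun c hc => ?_) ?_ (fun c c' _ _ h h' => ?_)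
      (fun s c _ h => ?_) hc
    · obtain ⟨a, ha, rfl⟩ := hc
      induction z using TensorProduct.induction_on with
      | zero => rw [smul_zero]; exact zero_mem _
      | add x y hx hy => rw [smul_add]; exact add_mem (hx trivial) (hy trivial)
      | tmul s t =>
        rw [algebraMap_smul, ← TensorProduct.tmul_smul]
        exact tmul_mem_baseChange_of_mem s (Submodule.smul_mem_smul ha trivial)
    · rw [zero_smul]
      exact zero_mem _
    · rw [add_smul]
      exact add_mem h h'
    · rw [smul_assoc]
      exact Submodule.smul_mem _ s h

/-- Length is multiplied by that of the closed fibre `S / 𝔪 S` under flat local base change; here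
the fibre is the residue field of `S`, of length `1`. -/
theorem length_baseChange_quotient_smul_top [IsLocalRing A] [IsLocalRing S] [Module.Flat A S]
    (hS : (IsLocalRing.maximalIdeal A).map (algebraMap A S) = IsLocalRing.maximalIdeal S)
    (I : Ideal A) (T : Type*) [AddCommGroup T] [Module A T] :
    Module.length S ((S ⊗[A] T) ⧸ (I.map (algebraMap A S) • ⊤ : Submodule S (S ⊗[A] T))) =
      Module.length A (T ⧸ (I • ⊤ : Submodule A T)) := by
  have : IsLocalHom (algebraMap A S) :=
    ((IsLocalRing.local_hom_TFAE (algebraMap A S)).out 0 2).2 hS.le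
  let ψ := (I • ⊤ : Submodule A T).mkQ.baseChange S
  have hψ : Function.Surjective ψ := LinearMap.lTensor_surjective S (Submodule.mkQ_surjective _)
  have hker : (I.map (algebraMap A S) • ⊤ : Submodule S (S ⊗[A] T)) = LinearMap.ker ψ := by
    rw [← Submodule.baseChange_smul_top]
    ext x
    exact Submodule.mem_baseChange_iff S _ x
  rw [((Submodule.quotEquivOfEq _ _ hker).trans (ψ.quotKerEquivOfSurjective hψ)).length_eq,
    IsLocalRing.length_baseChange, hS]
  have : IsSimpleModule S (S ⧸ IsLocalRing.maximalIdeal S) :=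
    isSimpleModule_iff_quot_maximal.2 ⟨_, inferInstance, ⟨LinearEquiv.refl _ _⟩⟩
  rw [Module.length_eq_one S (S ⧸ IsLocalRing.maximalIdeal S), mul_one]

/-- By surjectivity the preimage of `q` acts on `T` with image exactly `q`, and `A`-submodules of a
`k`-module are its `k`-submodules. -/
theorem length_quotient_smul_top_of_surjective {k : Type*} [CommRing k] [Algebra A k]
    (hk : Function.Surjective (algebraMap A k)) (q : Ideal k) (m : ℕ) (T : Type*)
    [AddCommGroup T] [Module A T] [Module k T] [IsScalarTower A k T] :
    Module.length A (T ⧸ (q.comap (algebraMap A k) ^ m • ⊤ : Submodule A T)) =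
      Module.length k (T ⧸ (q ^ m • ⊤ : Submodule k T)) := by
  rw [← Module.length_eq_of_surjective (S := A) (M := T ⧸ (q ^ m • ⊤ : Submodule k T)) hk]
  have h : (q.comap (algebraMap A k) ^ m • ⊤ : Submodule A T) =
      (q ^ m • ⊤ : Submodule k T).restrictScalars A := by
    conv_rhs => rw [← Ideal.map_comap_of_surjective _ hk q, ← Ideal.map_pow]
    rw [Ideal.smul_restrictScalars, Submodule.restrictScalars_top]
  rw [h]
  exact (Submodule.Quotient.restrictScalarsEquiv A _).length_eq

end Multiplicity

/-! ### Finite generation of the irrelevant ideal and of the graded ring. -/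

section Finiteness

variable {k R : Type u} [CommRing k] [CommRing R] [IsNoetherianRing R] [Algebra k R]
  (𝒜 : ℕ → Submodule k R) [GradedAlgebra 𝒜]

theorem exists_list_irrelevant_eq :
    ∃ l : List R, (∀ f ∈ l, ∃ a, f ∈ 𝒜 a) ∧
      (HomogeneousIdeal.irrelevant 𝒜).toIdeal = Ideal.ofList l := by
  have h := HomogeneousIdeal.irrelevant_eq_span 𝒜
  obtain ⟨t, ht, hspan⟩ := Submodule.fg_span_iff_fg_span_finset_subset
    (⋃ i > 0, (𝒜 i : Set R)) |>.1 (IsNoetherian.noetherian (Ideal.span (⋃ i > 0, (𝒜 i : Set R))))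
  refine ⟨t.toList, fun f hf => ?_, ?_⟩
  · have := ht (Finset.mem_toList.1 hf)
    simp only [Set.mem_iUnion] at this
    obtain ⟨i, _, hi⟩ := this
    exact ⟨i, hi⟩
  · rw [h, Ideal.ofList, Ideal.span, hspan, Ideal.span]
    congr 1
    ext x
    simp

/-- Finitely many elements of degree one generate the ideal spanned by `𝒜 1`. They also generate the
algebra, by the comparison of components of degree one. -/
theorem finiteType_of_homogeneous (h₀ : Function.Surjective (algebraMap k (𝒜 0)))
    (h₁ : Algebra.adjoin k (𝒜 1 : Set R) = ⊤) : Algebra.FiniteType k R := by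
  obtain ⟨t, ht, hspan⟩ := Submodule.fg_span_iff_fg_span_finset_subset
    (𝒜 1 : Set R) |>.1 (IsNoetherian.noetherian (Ideal.span (𝒜 1 : Set R)))
  refine ⟨⟨t, ?_⟩⟩
  rw [eq_top_iff, ← h₁, Algebra.adjoin_le_iff]
  intro x hx
  have hx' : x ∈ Ideal.span (t : Set R) := by
    rw [Ideal.span, ← hspan]
    exact Submodule.subset_span hx
  obtain ⟨c, -, hc⟩ := Submodule.mem_span_finset.1 hx'
  -- As `x` and every `f ∈ t` have degree one, only the degree-zero parts of the coefficients
  -- contribute, and these come from `k`.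
  have hdeg : x = ∑ f ∈ t, GradedRing.proj 𝒜 0 (c f) * f := by
    rw [← DirectSum.decompose_of_mem_same 𝒜 hx]
    rw [← hc, DirectSum.decompose_sum]
    simp only [smul_eq_mul, DirectSum.sum_apply, AddSubmonoidClass.coe_finsetSum]
    refine Finset.sum_congr rfl fun f hf => ?_
    have := DirectSum.coe_decompose_mul_add_of_right_mem 𝒜 (i := 0) (a := c f) (ht hf)
    rw [zero_add] at this
    exact this
  rw [hdeg]
  refine sum_mem fun f hf => mul_mem ?_ (Algebra.subset_adjoin hf)
  obtain ⟨a, ha⟩ := h₀ (DirectSum.decompose 𝒜 (c f) 0)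
  have : GradedRing.proj 𝒜 0 (c f) = algebraMap k R a := congrArg Subtype.val ha.symm
  rw [this]
  exact Subalgebra.algebraMap_mem _ a

end Finiteness

/-! ### The multiplicity formula. -/

theorem mainTheorem4
    {R₀ R₀' R₀'' R : Type u}
    [CommRing R₀] [IsLocalRing R₀] [IsNoetherianRing R₀]
    [CommRing R₀'] [IsLocalRing R₀'] [IsNoetherianRing R₀']
    [CommRing R₀''] [IsLocalRing R₀''] [IsNoetherianRing R₀'']
    [Algebra R₀' R₀] (hf : Function.Surjective (algebraMap R₀' R₀))
    [Algebra R₀' R₀''] [Module.Flat R₀' R₀'']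
    (hg : (IsLocalRing.maximalIdeal R₀').map (algebraMap R₀' R₀'') =
      IsLocalRing.maximalIdeal R₀'')
    [CommRing R] [IsNoetherianRing R] [Algebra R₀ R]
    [Algebra R₀' R] [IsScalarTower R₀' R₀ R]
    (𝒜 : ℕ → Submodule R₀ R) [GradedAlgebra 𝒜]
    (h𝒜₀ : Function.Bijective (algebraMap R₀ (𝒜 0)))
    (h𝒜₁ : Algebra.adjoin R₀ (𝒜 1 : Set R) = ⊤)
    (q₀ : Ideal R₀) (hq₀ : q₀.IsPrimary ∧ q₀.radical = IsLocalRing.maximalIdeal R₀)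
    (M : ZGradedModule 𝒜) [Module.Finite R M] [Module R₀' M] [IsScalarTower R₀' R₀ M]
    (i : ℕ) (n : ℤ) :
    hilbertSamuelMultiplicity q₀
        (M.localCohomology (HomogeneousIdeal.irrelevant 𝒜).toIdeal i n) =
      hilbertSamuelMultiplicity
        ((q₀.comap (algebraMap R₀' R₀)).map (algebraMap R₀' R₀''))
        ((M.baseChange R₀' R₀'').localCohomology
          ((HomogeneousIdeal.irrelevant 𝒜).toIdeal.map
            (Algebra.TensorProduct.includeRight : R →ₐ[R₀'] R₀'' ⊗[R₀'] R)) i n) := by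
  obtain ⟨l, hl, hJ⟩ := exists_list_irrelevant_eq 𝒜
  have hft : Algebra.FiniteType R₀ R := finiteType_of_homogeneous 𝒜 h𝒜₀.2 h𝒜₁
  have : Algebra.FiniteType R₀' R₀ := .of_surjective (Algebra.ofId R₀' R₀) hf
  have : Algebra.FiniteType R₀' R := .trans this hft
  -- Needed so that graded injectives over the base-changed ring are acyclic.
  have : IsNoetherianRing (R₀'' ⊗[R₀'] R) := Algebra.FiniteType.isNoetherianRing R₀'' _
  unfold ZGradedModule.localCohomology
  -- The chosen resolutions are unrelated, so the comparison is made for arbitrary `E` and `I`.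
  generalize Classical.choice M.nonempty_injectiveResolution = E
  generalize Classical.choice (M.baseChange R₀' R₀'').nonempty_injectiveResolution = I
  let _ : ∀ i, Module R₀' (E.obj i) := fun i => Module.compHom _ (algebraMap R₀' R₀)
  have : ∀ i, IsScalarTower R₀' R₀ (E.obj i) := fun i => .of_algebraMap_smul fun _ _ => rfl
  have hl' : ∀ f ∈ l.map (Algebra.TensorProduct.includeRight : R →ₐ[R₀'] R₀'' ⊗[R₀'] R),
      ∃ a, f ∈ ZGradedModule.baseChangeGrading R₀' R₀'' 𝒜 a := by
    intro f hf
    obtain ⟨g, hg, rfl⟩ := List.mem_map.1 hf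
    obtain ⟨a, ha⟩ := hl g hg
    exact ⟨a, Submodule.tmul_mem_baseChange_of_mem 1 ha⟩
  obtain ⟨e₁⟩ := (E.baseChange R₀' R₀'').nonempty_cohomology_equiv
    ((HomogeneousIdeal.irrelevant 𝒜).toIdeal.map Algebra.TensorProduct.includeRight) hl'
    (by rw [hJ]; exact Ideal.map_ofList _ l)
    (fun i => ZGradedModule.isTorsionAcyclic_baseChange R₀' R₀'' _
      ((E.injective i).isTorsionAcyclic hl)) I i n
  obtain ⟨e₂⟩ := E.nonempty_baseChange_cohomology_equiv R₀' R₀'' hJ i n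
  refine hilbertSamuelMultiplicity_congr fun m => ?_
  -- Lengths are carried from the cohomology of `I` to `R₀'' ⊗ H`, then to `H` over `R₀'`, then to
  -- `H` over `R₀`.
  rw [← (e₁.symm.trans e₂).symm.length_quotient_smul_top_eq, ← Ideal.map_pow,
    length_baseChange_quotient_smul_top R₀'' hg, length_quotient_smul_top_of_surjective hf]
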